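/- For $d,n\in\mathbb N$, $\rho\in(0,1]$ and $\sigma>0$, let $D_\emptyset$ be the density of $N(0,\mathrm{Id}_d)$. For a unit vector $u\in\mathbb R^d$ let $D_{u,\sigma}$ be the density of a sample $z\sim N(xu,\ \mathrm{Id}_d-uu^\top+\sigma^2uu^\top)$, where $x$ is Bernoulli–Rademacher: $x=\pm1/\sqrt\rho$ with probability $\rho/2$ each and $x=0$ with probability $1-\rho$. Put $\bar D_{u,\sigma}=D_{u,\sigma}/D_\emptyset$ and $\bar D_{u,\sigma}^{\otimes n}(z_1,\dots,z_n)=\prod_{i=1}^n\bar D_{u,\sigma}(z_i)$, let $u$ be uniform on the unit sphere $S^{d-1}$, and let $\|f\|^2=\mathbb E_{z\sim D_\emptyset^{\otimes n}}f(z)^2$. A polynomial in $(z_1,\dots,z_n)\in(\mathbb R^d)^n$ has samplewise degree at most $(\infty,k)$ if it is a linear combination of polynomials (of any degree), each of which depends on at most $k$ of the $z_i$. Let $f\mapsto f^{\le\infty,k}$ be the orthogonal projection in $L^2(D_\emptyset^{\otimes n})$ onto the closed span of these polynomials. Then there are universal constants $K>0$, $C$ and $d_0$ such that the following holds for all integers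 $d\ge d_0$, $n\ge 0$, $k\ge 0$ and all reals $\rho\in(0,1]$, $\sigma>0$: if $$\sigma\le d^{-K},\qquad \rho\ge\frac{k}{\sqrt d},\qquad n\le\frac{\rho^2d^2}{k^8},\qquad \log^2 d\le k\le\sqrt{\frac{d}{\log d}},$$ then the $n$-sample likelihood ratio $\mathbb E_{u}\bar D_{u,\sigma}^{\otimes n}$ lies in $L^2(D_\emptyset^{\otimes n})$ and $$\Big\|\big(\mathbb E_{u\sim S^{d-1}}\bar D_{u,\sigma}^{\otimes n}\big)^{\le\infty,k}-1\Big\|^2\le C.$$ -/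

import Mathlib

open MeasureTheory ProbabilityTheory

namespace SparsePlanted

noncomputable section

/-- Bernoulli-Rademacher law with parameter `ρ`: the values `1/√ρ`, `-1/√ρ` with probability `ρ/2`
each, and `0` with probability `1 - ρ`. -/
def bernoulliRademacher (ρ : ℝ) : Measure ℝ :=
  ENNReal.ofReal (ρ / 2) • Measure.dirac (1 / √ρ)
    + ENNReal.ofReal (ρ / 2) • Measure.dirac (-(1 / √ρ))
    + ENNReal.ofReal (1 - ρ) • Measure.dirac 0

/-- The unit sphere of `ℝ^d`. -/
abbrev UnitSphere (d : ℕ) : Type :=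
  Metric.sphere (0 : EuclideanSpace ℝ (Fin d)) 1

/-- The uniform probability measure on the unit sphere of `ℝ^d` (normalized surface measure). -/
def uniformSphere (d : ℕ) : Measure (UnitSphere d) :=
  ((volume : Measure (EuclideanSpace ℝ (Fin d))).toSphere Set.univ)⁻¹ •
    (volume : Measure (EuclideanSpace ℝ (Fin d))).toSphere

/-- Lebesgue density of the Gaussian law `N(m, S)` on `ℝ^d`, for a positive definite
covariance matrix `S`. -/
def gaussianDensity {d : ℕ} (m : EuclideanSpace ℝ (Fin d)) (S : Matrix (Fin d) (Fin d) ℝ)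
    (z : EuclideanSpace ℝ (Fin d)) : ℝ :=
  (√((2 * Real.pi) ^ d * S.det))⁻¹ *
    Real.exp (-(1 / 2) * ((z - m).ofLp ⬝ᵥ (S⁻¹).mulVec (z - m).ofLp))

/-- The covariance matrix `Id - u uᵀ + σ² u uᵀ`. -/
def plantedCov {d : ℕ} (σ : ℝ) (u : EuclideanSpace ℝ (Fin d)) : Matrix (Fin d) (Fin d) ℝ :=
  1 - Matrix.vecMulVec u.ofLp u.ofLp + σ ^ 2 • Matrix.vecMulVec u.ofLp u.ofLp

/-- The density `D_{u,σ}` of one planted sample with hidden direction `u`: the mixture over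
`x ∼ BR(ρ)` of the densities of `N(x u, Id - u uᵀ + σ² u uᵀ)`. -/
def plantedDensity {d : ℕ} (ρ σ : ℝ) (u z : EuclideanSpace ℝ (Fin d)) : ℝ :=
  ∫ x, gaussianDensity (x • u) (plantedCov σ u) z ∂(bernoulliRademacher ρ)

/-- The relative density of one planted sample with respect to the standard Gaussian law. -/
def relDensity {d : ℕ} (ρ σ : ℝ) (u z : EuclideanSpace ℝ (Fin d)) : ℝ :=
  plantedDensity ρ σ u z / gaussianDensity 0 1 z

/-- The null law: `n` independent standard Gaussian samples in `ℝ^d`. -/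
def nullLaw (n d : ℕ) : Measure (Fin n → EuclideanSpace ℝ (Fin d)) :=
  Measure.pi fun _ => stdGaussian (EuclideanSpace ℝ (Fin d))

instance (n d : ℕ) : IsProbabilityMeasure (nullLaw n d) := by
  unfold nullLaw; infer_instance

/-- The `n`-sample likelihood ratio: the mean over a uniform unit vector `u` of the product of the
relative densities of the `n` samples. -/
def likelihoodRatio (n d : ℕ) (ρ σ : ℝ) (z : Fin n → EuclideanSpace ℝ (Fin d)) : ℝ :=
  ∫ u, ∏ i, relDensity ρ σ (u : EuclideanSpace ℝ (Fin d)) (z i) ∂(uniformSphere d)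

/-- Polynomials in `n` samples from `ℝ^d` of samplewise degree at most `(ℓ, k)`: each monomial has
degree at most `ℓ` in every sample and nonzero degree in at most `k` samples. The value `ℓ = ⊤`
puts no bound on the degree. The variable `(i, j)` is coordinate `j` of sample `i`. -/
def samplewiseDegreeLE (n d : ℕ) (ℓ : ℕ∞) (k : ℕ) :
    Submodule ℝ (MvPolynomial (Fin n × Fin d) ℝ) :=
  MvPolynomial.restrictSupport ℝ
    {m | (∀ i, ((∑ j, m (i, j) : ℕ) : ℕ∞) ≤ ℓ) ∧
      (Finset.univ.filter fun i => ∑ j, m (i, j) ≠ 0).card ≤ k}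

/-- The elements of `L²` of the null law represented by polynomials of samplewise degree
at most `(ℓ, k)`. -/
def samplewiseSpan (n d : ℕ) (ℓ : ℕ∞) (k : ℕ) : Submodule ℝ (Lp ℝ 2 (nullLaw n d)) where
  carrier := {g | ∃ p ∈ samplewiseDegreeLE n d ℓ k,
    g =ᵐ[nullLaw n d] fun z => MvPolynomial.eval (fun ij => z ij.1 ij.2) p}
  zero_mem' := ⟨0, zero_mem _, by
    filter_upwards [Lp.coeFn_zero ℝ 2 (nullLaw n d)] with z hz
    rw [hz, map_zero, Pi.zero_apply]⟩
  add_mem' := by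
    rintro f g ⟨p, hp, hfp⟩ ⟨q, hq, hgq⟩
    refine ⟨p + q, add_mem hp hq, ?_⟩
    filter_upwards [Lp.coeFn_add f g, hfp, hgq] with z h1 h2 h3
    rw [map_add, ← h2, ← h3]
    exact h1
  smul_mem' := by
    rintro c f ⟨p, hp, hfp⟩
    refine ⟨c • p, Submodule.smul_mem _ c hp, ?_⟩
    filter_upwards [Lp.coeFn_smul c f, hfp] with z h1 h2
    rw [MvPolynomial.smul_eval, ← h2]
    exact h1

/-- Orthogonal projection `f ↦ f^{≤ ℓ, k}` in `L²` of the null law onto the closed span of the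
polynomials of samplewise degree at most `(ℓ, k)`. -/
def lowDegreeProj (n d : ℕ) (ℓ : ℕ∞) (k : ℕ) :
    Lp ℝ 2 (nullLaw n d) →L[ℝ] Lp ℝ 2 (nullLaw n d) :=
  (samplewiseSpan n d ℓ k).topologicalClosure.starProjection

/-- The `(ℓ, k)` low-degree likelihood ratio of `n` samples, centred by its mean `1`. -/
def lowDegreeLR (n d : ℕ) (ℓ : ℕ∞) (k : ℕ) (ρ σ : ℝ)
    (h : MemLp (likelihoodRatio n d ρ σ) 2 (nullLaw n d)) : Lp ℝ 2 (nullLaw n d) :=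
  lowDegreeProj n d ℓ k (h.toLp (likelihoodRatio n d ρ σ)) - Lp.const 2 (nullLaw n d) 1

end

end SparsePlanted

/-!
The relative density of a planted sample depends on `z` only through the coordinate `⟨u, z⟩`; it is
bounded, because `σ > 0`, and has mean `1`. Expand the product of the densities of the `n` samples
over sets of samples. After averaging over `u`, the terms with more than `k` samples are orthogonal
to every polynomial in which each monomial involves at most `k` samples, so the centred low-degree
likelihood ratio is the projection of the average over `u` of the terms with `1` to `k` samples.
Distinct sets give orthogonal terms, whence (`exists_norm_lowDegreeLR_sq_le`) the squared norm is at
most `E_{u, v} ∑_{1 ≤ j ≤ k} (n choose j) G(⟨u, v⟩) ^ j`, where `G(t)` is the covariance of the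
relative densities in two directions of inner product `t` (`overlap - 1`).

By Mehler's formula the overlap is explicit (`integral_profile_mul`, `overlap_eq`). Two bounds of it
suffice. For `|t| ≤ ρ / 2` one has `|G(t)| ≤ 20 t⁴ / ρ² + σ⁴ t²`, since the Bernoulli-Rademacher law
has the first three moments of the Gaussian one (`abs_overlap_sub_one_le_of_small`). For all `t`,
`|G(t)| ≤ (1 - r² t²) ^ (-1/2) * exp (|t| / ρ)` with `r = 1 - σ²` (`abs_overlap_sub_one_le`).

A coordinate `t` of a uniform point of the sphere is, up to constants, dominated by a Gaussian
variable of variance `1 / d` (`integral_uniformSphere_le`), and `(1 - r² t²) ^ (-k)` has mean at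
most `(C d) ^ k`, uniformly in `r < 1` (`integral_uniformSphere_inv_pow_le`). So the terms
`n ^ j t ^ (4 j) / ρ ^ (2 j)` have a mean of order `(C j⁴ n / (ρ² d²)) ^ j`, which is summable since
`n ≤ ρ² d² / k⁸`. On `|t| > ρ / 2` put `a = √d |t|`; then `a ≥ k / 2` and `k |t| / ρ ≤ a`, as
`ρ ≥ k / √d`. The sum is at most `d ^ (3 k) exp a` times a singular factor, and the Gaussian tail
gains `exp (-c k²)`, which beats every `d ^ (C k)` because `k ≥ log² d`.
-/

open scoped ENNReal

namespace SparsePlanted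

/-! ### Gaussian integrals and the relative density of one sample -/

theorem integral_exp_quadratic_gaussianReal (p q s : ℝ) (hp : -1 < p) :
    ∫ x, Real.exp (-(p * x ^ 2) / 2 + q * x + s) ∂(gaussianReal 0 1)
      = (√(1 + p))⁻¹ * Real.exp (q ^ 2 / (2 * (1 + p)) + s) := by
  have hp' : 0 < 1 + p := by linarith
  rw [integral_gaussianReal_eq_integral_smul one_ne_zero]
  have h : ∀ x : ℝ, gaussianPDFReal 0 1 x • Real.exp (-(p * x ^ 2) / 2 + q * x + s)
      = ((√(2 * Real.pi))⁻¹ * Real.exp (q ^ 2 / (2 * (1 + p)) + s)) *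
        Real.exp (-((1 + p) / 2) * (x - q / (1 + p)) ^ 2) := by
    intro x
    simp only [gaussianPDFReal, NNReal.coe_one, mul_one, sub_zero, smul_eq_mul]
    rw [mul_assoc, mul_assoc, ← Real.exp_add, ← Real.exp_add]
    congr 2
    field_simp
    ring
  simp_rw [h]
  rw [integral_const_mul, integral_sub_right_eq_self
    (fun x => Real.exp (-((1 + p) / 2) * x ^ 2)) (q / (1 + p)), integral_gaussian]
  rw [show Real.pi / ((1 + p) / 2) = (2 * Real.pi) * (1 + p)⁻¹ by field_simp,
    Real.sqrt_mul (by positivity : (0 : ℝ) ≤ 2 * Real.pi), Real.sqrt_inv]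
  have : √(2 * Real.pi) ≠ 0 := by positivity
  field_simp

/-- The density of `N(x, σ²)` relative to `N(0, 1)`, at the point `a`. -/
noncomputable def shiftRatio (σ x a : ℝ) : ℝ :=
  σ⁻¹ * Real.exp (-(a - x) ^ 2 / (2 * σ ^ 2) + a ^ 2 / 2)

open Matrix in
theorem plantedCov_eq {d : ℕ} (σ : ℝ) (u : EuclideanSpace ℝ (Fin d)) :
    plantedCov σ u = 1 + (σ ^ 2 - 1) • vecMulVec u.ofLp u.ofLp := by
  rw [plantedCov, sub_smul, one_smul]
  abel

theorem ofLp_dotProduct {d : ℕ} (u v : EuclideanSpace ℝ (Fin d)) :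
    u.ofLp ⬝ᵥ v.ofLp = inner ℝ u v := by
  rw [EuclideanSpace.inner_eq_star_dotProduct, dotProduct_comm]
  simp

open Matrix in
/-- `plantedCov` is a rank-one perturbation of the identity, so the matrix determinant lemma
applies. -/
theorem det_plantedCov {d : ℕ} (σ : ℝ) (u : EuclideanSpace ℝ (Fin d)) (hu : ‖u‖ = 1) :
    (plantedCov σ u).det = σ ^ 2 := by
  have h : u.ofLp ⬝ᵥ u.ofLp = 1 := by
    rw [ofLp_dotProduct, real_inner_self_eq_norm_sq, hu, one_pow]
  rw [plantedCov_eq, ← smul_vecMulVec, vecMulVec_eq Unit,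
    det_one_add_replicateCol_mul_replicateRow, dotProduct_smul, h]
  simp

open Matrix in
/-- `plantedCov` scales the line of `u` by `σ²` and fixes its orthogonal complement. -/
theorem inv_plantedCov {d : ℕ} {σ : ℝ} (hσ : 0 < σ) (u : EuclideanSpace ℝ (Fin d))
    (hu : ‖u‖ = 1) :
    (plantedCov σ u)⁻¹ = 1 + ((σ ^ 2)⁻¹ - 1) • vecMulVec u.ofLp u.ofLp := by
  have h : u.ofLp ⬝ᵥ u.ofLp = 1 := by
    rw [ofLp_dotProduct, real_inner_self_eq_norm_sq, hu, one_pow]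
  have hU : vecMulVec u.ofLp u.ofLp * vecMulVec u.ofLp u.ofLp = vecMulVec u.ofLp u.ofLp := by
    rw [vecMulVec_mul_vecMulVec, h, one_smul]
  apply inv_eq_right_inv
  rw [plantedCov_eq, add_mul, mul_add, mul_add, one_mul, mul_one, one_mul, smul_mul_smul_comm, hU,
    add_assoc, ← add_smul, ← add_smul]
  have : (σ ^ 2)⁻¹ - 1 + (σ ^ 2 - 1 + (σ ^ 2 - 1) * ((σ ^ 2)⁻¹ - 1)) = 0 := by
    field_simp
    ring
  rw [this, zero_smul, add_zero]

open Matrix in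
/-- A planted component differs from the null law only in the direction `u`: the quotient of the
densities is the one-dimensional one, at the coordinate `⟨u, z⟩`. -/
theorem gaussianDensity_planted_div {d : ℕ} {σ : ℝ} (hσ : 0 < σ) (x : ℝ)
    (u z : EuclideanSpace ℝ (Fin d)) (hu : ‖u‖ = 1) :
    gaussianDensity (x • u) (plantedCov σ u) z / gaussianDensity 0 1 z
      = shiftRatio σ x (inner ℝ u z) := by
  have hq : (z - x • u).ofLp ⬝ᵥ ((plantedCov σ u)⁻¹).mulVec (z - x • u).ofLp
      = ‖z‖ ^ 2 - (inner ℝ u z : ℝ) ^ 2 + (σ ^ 2)⁻¹ * (inner ℝ u z - x) ^ 2 := by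
    rw [inv_plantedCov hσ u hu, add_mulVec, one_mulVec, smul_mulVec, vecMulVec_mulVec,
      dotProduct_add, dotProduct_smul]
    simp only [op_smul_eq_smul, dotProduct_smul, ofLp_dotProduct, inner_sub_left, inner_sub_right,
      inner_smul_left, inner_smul_right, real_inner_self_eq_norm_sq, hu, smul_eq_mul,
      real_inner_comm u z]
    simp
    ring
  have h0 : z.ofLp ⬝ᵥ z.ofLp = ‖z‖ ^ 2 := by rw [ofLp_dotProduct, real_inner_self_eq_norm_sq]
  unfold gaussianDensity
  rw [hq, det_plantedCov σ u hu]
  simp only [sub_zero, inv_one, one_mulVec, det_one, mul_one, h0]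
  rw [Real.sqrt_mul (by positivity), Real.sqrt_sq hσ.le, mul_div_mul_comm, ← Real.exp_sub,
    shiftRatio]
  congr 1
  · have : √((2 * Real.pi) ^ d) ≠ 0 := by positivity
    field_simp
  · congr 1
    field_simp
    ring

theorem integral_bernoulliRademacher {ρ : ℝ} (h0 : 0 ≤ ρ) (h1 : ρ ≤ 1) (f : ℝ → ℝ) :
    ∫ x, f x ∂(bernoulliRademacher ρ)
      = ρ / 2 * f (1 / √ρ) + ρ / 2 * f (-(1 / √ρ)) + (1 - ρ) * f 0 := by
  have hi : ∀ c : ℝ, ∀ a : ℝ, Integrable f (ENNReal.ofReal c • Measure.dirac a) := fun c a =>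
    (integrable_dirac (by simp)).smul_measure ENNReal.ofReal_ne_top
  rw [bernoulliRademacher, integral_add_measure ((hi _ _).add_measure (hi _ _)) (hi _ _),
    integral_add_measure (hi _ _) (hi _ _)]
  simp only [integral_smul_measure, integral_dirac]
  rw [ENNReal.toReal_ofReal (by linarith), ENNReal.toReal_ofReal (by linarith)]
  simp

theorem relDensity_eq {d : ℕ} {ρ σ : ℝ} (hσ : 0 < σ)
    (u z : EuclideanSpace ℝ (Fin d)) (hu : ‖u‖ = 1) :
    relDensity ρ σ u z = ∫ x, shiftRatio σ x (inner ℝ u z) ∂(bernoulliRademacher ρ) := by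
  rw [relDensity, plantedDensity, ← integral_div]
  simp_rw [gaussianDensity_planted_div hσ _ u z hu]

theorem shiftRatio_nonneg {σ : ℝ} (hσ : 0 < σ) (x a : ℝ) : 0 ≤ shiftRatio σ x a := by
  unfold shiftRatio; positivity

/-- The relative density of `N(x, σ²)` is bounded because `σ < 1`; its exponent is a downward
parabola with maximum `x ^ 2 / (2 * (1 - σ ^ 2))`. -/
theorem shiftRatio_le {σ : ℝ} (hσ : 0 < σ) (hσ1 : σ < 1) (x a : ℝ) :
    shiftRatio σ x a ≤ σ⁻¹ * Real.exp (x ^ 2 / (2 * (1 - σ ^ 2))) := by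
  have h1 : 0 < 1 - σ ^ 2 := by nlinarith
  unfold shiftRatio
  gcongr
  have : x ^ 2 / (2 * (1 - σ ^ 2)) - (-(a - x) ^ 2 / (2 * σ ^ 2) + a ^ 2 / 2)
      = ((1 - σ ^ 2) * a - x) ^ 2 / (2 * σ ^ 2 * (1 - σ ^ 2)) := by
    field_simp
    ring
  have h2 : 0 ≤ ((1 - σ ^ 2) * a - x) ^ 2 / (2 * σ ^ 2 * (1 - σ ^ 2)) := by positivity
  linarith

theorem continuous_shiftRatio (σ x : ℝ) : Continuous (shiftRatio σ x) := by
  unfold shiftRatio; fun_prop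

theorem integral_shiftRatio {σ : ℝ} (hσ : 0 < σ) (x : ℝ) :
    ∫ a, shiftRatio σ x a ∂(gaussianReal 0 1) = 1 := by
  have h : ∀ a, shiftRatio σ x a = σ⁻¹ * Real.exp (-(((σ ^ 2)⁻¹ - 1) * a ^ 2) / 2
      + (x / σ ^ 2) * a + -(x ^ 2) / (2 * σ ^ 2)) := by
    intro a
    unfold shiftRatio
    congr 2
    field_simp
    ring
  have hp : -1 < (σ ^ 2)⁻¹ - 1 := by
    have : 0 < (σ ^ 2)⁻¹ := by positivity
    linarith
  simp_rw [h]
  rw [integral_const_mul, integral_exp_quadratic_gaussianReal _ _ _ hp]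
  have h3 : √(1 + ((σ ^ 2)⁻¹ - 1)) = σ⁻¹ := by
    rw [add_sub_cancel, Real.sqrt_inv, Real.sqrt_sq hσ.le]
  have h4 : (x / σ ^ 2) ^ 2 / (2 * (1 + ((σ ^ 2)⁻¹ - 1))) + -(x ^ 2) / (2 * σ ^ 2) = 0 := by
    rw [add_sub_cancel]
    field_simp
    ring
  rw [h3, h4, Real.exp_zero]
  field_simp

/-- The correlation of the relative densities of `N(x, σ²)` and `N(y, σ²)` at two standard
Gaussians of correlation `t`, where `r = 1 - σ²`: Mehler's kernel. -/
noncomputable def mehler (r t x y : ℝ) : ℝ :=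
  (√(1 - r ^ 2 * t ^ 2))⁻¹ *
    Real.exp ((2 * t * x * y - r * t ^ 2 * (x ^ 2 + y ^ 2)) / (2 * (1 - r ^ 2 * t ^ 2)))

/-- The inner of the two Gaussian integrals that produce Mehler's kernel; `t a + √(1 - t²) b` has
correlation `t` with `a`. -/
theorem integral_shiftRatio_rotate {σ t : ℝ} (hσ : 0 < σ) (hσ1 : σ < 1) (ht : t ^ 2 ≤ 1)
    (y a : ℝ) :
    ∫ b, shiftRatio σ y (t * a + √(1 - t ^ 2) * b) ∂(gaussianReal 0 1)
      = (√(1 - (1 - σ ^ 2) * t ^ 2))⁻¹ * Real.exp ((2 * t * a * y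
        - (1 - σ ^ 2) * t ^ 2 * a ^ 2 - t ^ 2 * y ^ 2) / (2 * (1 - (1 - σ ^ 2) * t ^ 2))) := by
  have hs : 0 < σ ^ 2 := by positivity
  have hs1 : σ ^ 2 < 1 := by nlinarith
  set w := √(1 - t ^ 2) with hw
  have hw2 : w ^ 2 = 1 - t ^ 2 := Real.sq_sqrt (by linarith)
  have hD : 0 < 1 - (1 - σ ^ 2) * t ^ 2 := by nlinarith
  have h : ∀ b, shiftRatio σ y (t * a + w * b) = σ⁻¹ * Real.exp
      (-(((1 - σ ^ 2) * w ^ 2 / σ ^ 2) * b ^ 2) / 2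
        + ((y * w - (1 - σ ^ 2) * t * a * w) / σ ^ 2) * b
        + -((1 - σ ^ 2) * t ^ 2 * a ^ 2 - 2 * y * t * a + y ^ 2) / (2 * σ ^ 2)) := by
    intro b
    unfold shiftRatio
    congr 2
    field_simp
    ring
  have hp0 : 0 ≤ (1 - σ ^ 2) * w ^ 2 / σ ^ 2 := by
    have : 0 ≤ 1 - σ ^ 2 := by linarith
    positivity
  have hp : 1 + (1 - σ ^ 2) * w ^ 2 / σ ^ 2 = (1 - (1 - σ ^ 2) * t ^ 2) / σ ^ 2 := by
    rw [hw2]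
    field_simp
    ring
  simp_rw [h]
  rw [integral_const_mul, integral_exp_quadratic_gaussianReal _ _ _ (by linarith), hp,
    Real.sqrt_div hD.le, Real.sqrt_sq hσ.le, ← mul_assoc]
  congr 1
  · field_simp
  · congr 1
    have : (y * w - (1 - σ ^ 2) * t * a * w) ^ 2
        = (1 - t ^ 2) * (y - (1 - σ ^ 2) * t * a) ^ 2 := by
      rw [← hw2]
      ring
    rw [div_pow, this]
    have hD' := hD.ne'
    obtain ⟨D, hDe⟩ : ∃ D, D = 1 - (1 - σ ^ 2) * t ^ 2 := ⟨_, rfl⟩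
    rw [← hDe] at hD' ⊢
    field_simp
    rw [hDe]
    ring

theorem integral_shiftRatio_mul {σ t : ℝ} (hσ : 0 < σ) (hσ1 : σ < 1) (ht : t ^ 2 ≤ 1)
    (x y : ℝ) :
    ∫ a, shiftRatio σ x a * ∫ b, shiftRatio σ y (t * a + √(1 - t ^ 2) * b) ∂(gaussianReal 0 1)
        ∂(gaussianReal 0 1) = mehler (1 - σ ^ 2) t x y := by
  have hs : 0 < σ ^ 2 := by positivity
  have hs1 : σ ^ 2 < 1 := by nlinarith
  simp_rw [integral_shiftRatio_rotate hσ hσ1 ht]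
  obtain ⟨D, hD⟩ : ∃ D, D = 1 - (1 - σ ^ 2) * t ^ 2 := ⟨_, rfl⟩
  have hD0 : 0 < D := by rw [hD]; nlinarith
  have hE : 0 < 1 - (1 - σ ^ 2) ^ 2 * t ^ 2 := by
    have : (1 - σ ^ 2) ^ 2 < 1 := by nlinarith
    nlinarith
  rw [← hD]
  have h : ∀ a, shiftRatio σ x a * ((√D)⁻¹ * Real.exp ((2 * t * a * y
        - (1 - σ ^ 2) * t ^ 2 * a ^ 2 - t ^ 2 * y ^ 2) / (2 * D)))
      = (σ⁻¹ * (√D)⁻¹) * Real.exp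
      (-(((1 - σ ^ 2) / σ ^ 2 + (1 - σ ^ 2) * t ^ 2 / D) * a ^ 2) / 2
        + (x / σ ^ 2 + t * y / D) * a
        + (-x ^ 2 / (2 * σ ^ 2) - t ^ 2 * y ^ 2 / (2 * D))) := by
    intro a
    unfold shiftRatio
    rw [mul_mul_mul_comm, ← Real.exp_add]
    congr 2
    field_simp
    ring
  have hp0 : 0 ≤ (1 - σ ^ 2) / σ ^ 2 + (1 - σ ^ 2) * t ^ 2 / D := by
    have : 0 ≤ 1 - σ ^ 2 := by linarith
    positivity
  have hp : 1 + ((1 - σ ^ 2) / σ ^ 2 + (1 - σ ^ 2) * t ^ 2 / D)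
      = (1 - (1 - σ ^ 2) ^ 2 * t ^ 2) / (σ ^ 2 * D) := by
    field_simp
    rw [hD]
    ring
  simp_rw [h]
  rw [integral_const_mul, integral_exp_quadratic_gaussianReal _ _ _ (by linarith), hp,
    Real.sqrt_div hE.le, Real.sqrt_mul hs.le, Real.sqrt_sq hσ.le, ← mul_assoc, mehler]
  congr 1
  · have : √D ≠ 0 := by positivity
    field_simp
  · congr 1
    have hE' := hE.ne'
    obtain ⟨F, hF⟩ : ∃ F, F = 1 - (1 - σ ^ 2) ^ 2 * t ^ 2 := ⟨_, rfl⟩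
    rw [← hF] at hE' ⊢
    have hD' := hD0.ne'
    field_simp
    rw [hF, hD]
    ring

/-! ### Correlation of the relative densities in two directions -/

section GaussianLaws

variable {E : Type*} [NormedAddCommGroup E] [InnerProductSpace ℝ E] [FiniteDimensional ℝ E]
  [MeasurableSpace E] [BorelSpace E]

theorem stdGaussian_map_inner (u : E) (hu : ‖u‖ = 1) :
    (stdGaussian E).map (fun z => inner ℝ u z) = gaussianReal 0 1 := by
  have h := IsGaussian.map_eq_gaussianReal (μ := stdGaussian E) (innerSL ℝ u)
  rw [integral_strongDual_stdGaussian, variance_dual_stdGaussian, innerSL_apply_norm, hu] at h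
  simpa using h

theorem charFunDual_gaussianReal_zero_one (N : StrongDual ℝ ℝ) :
    charFunDual (gaussianReal 0 1) N = Complex.exp (-(N 1 : ℂ) ^ 2 / 2) := by
  have h : charFunDual (gaussianReal 0 1) N = charFun (gaussianReal 0 1) (N 1) := by
    rw [charFunDual_apply, charFun_apply_real]
    refine integral_congr_ae (Filter.Eventually.of_forall fun x => ?_)
    have : N x = x * N 1 := by
      conv_lhs => rw [← mul_one x, ← smul_eq_mul, map_smul, smul_eq_mul]
    simp only [this]
    push_cast
    ring_nf
  rw [h, charFun_gaussianReal]
  simp [neg_div]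

/-- Two coordinates of a standard Gaussian vector, in unit directions of inner product `t`, are
realized by two independent standard Gaussians `g₁`, `g₂` as `g₁` and `t g₁ + √(1 - t²) g₂`. -/
theorem stdGaussian_map_inner_prod (u v : E) (hu : ‖u‖ = 1) (hv : ‖v‖ = 1) :
    (stdGaussian E).map (fun z => ((inner ℝ u z : ℝ), (inner ℝ v z : ℝ)))
      = ((gaussianReal 0 1).prod (gaussianReal 0 1)).map
        (fun p => (p.1, inner ℝ u v * p.1 + √(1 - (inner ℝ u v) ^ 2) * p.2)) := by
  set t : ℝ := inner ℝ u v with ht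
  set w := √(1 - t ^ 2) with hw
  have ht1 : t ^ 2 ≤ 1 := by
    have := abs_real_inner_le_norm u v
    rw [hu, hv, one_mul] at this
    rw [← sq_abs]
    exact pow_le_one₀ (abs_nonneg _) this
  have hw2 : w ^ 2 = 1 - t ^ 2 := Real.sq_sqrt (by linarith)
  let f : E →L[ℝ] ℝ × ℝ := (innerSL ℝ u).prod (innerSL ℝ v)
  let M : ℝ × ℝ →L[ℝ] ℝ × ℝ := (ContinuousLinearMap.fst ℝ ℝ ℝ).prod
    (t • ContinuousLinearMap.fst ℝ ℝ ℝ + w • ContinuousLinearMap.snd ℝ ℝ ℝ)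
  have hf : (fun z => ((inner ℝ u z : ℝ), (inner ℝ v z : ℝ))) = f := by ext z <;> simp [f]
  have hM : (fun p : ℝ × ℝ => (p.1, t * p.1 + w * p.2)) = M := by ext z <;> simp [M]
  rw [hf, hM]
  apply Measure.ext_of_charFunDual
  ext L
  rw [charFunDual_map, charFunDual_map, charFunDual_stdGaussian, charFunDual_prod,
    charFunDual_gaussianReal_zero_one, charFunDual_gaussianReal_zero_one, ← Complex.exp_add]
  have hL : ∀ a b : ℝ, L (a, b) = a * L (1, 0) + b * L (0, 1) := by
    intro a b
    rw [← smul_eq_mul, ← smul_eq_mul, ← map_smul, ← map_smul, ← map_add]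
    simp
  have h1 : L.comp f = innerSL ℝ (L (1, 0) • u + L (0, 1) • v) := by
    ext z
    have : (L.comp f) z = L (inner ℝ u z, inner ℝ v z) := rfl
    rw [this, hL, innerSL_apply_apply, inner_add_left, inner_smul_left, inner_smul_left]
    simp
    ring
  have h2 : ‖L.comp f‖ ^ 2 = L (1, 0) ^ 2 + 2 * L (1, 0) * L (0, 1) * t + L (0, 1) ^ 2 := by
    rw [h1, innerSL_apply_norm, norm_add_sq_real, norm_smul, norm_smul, hu, hv,
      inner_smul_left, inner_smul_right, ← ht]
    simp
    ring
  have h3 : ((L.comp M).comp (.inl ℝ ℝ ℝ)) 1 = L (1, 0) + t * L (0, 1) := by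
    simp [M, hL 1 t]
  have h4 : ((L.comp M).comp (.inr ℝ ℝ ℝ)) 1 = w * L (0, 1) := by
    simp [M, hL 0 w]
  rw [h3, h4]
  congr 1
  norm_cast
  rw [h2]
  have : (w * L (0, 1)) ^ 2 = (1 - t ^ 2) * L (0, 1) ^ 2 := by rw [mul_pow, hw2]
  rw [this]
  ring

theorem integral_stdGaussian_inner (u : E) (hu : ‖u‖ = 1) {f : ℝ → ℝ} (hf : Continuous f) :
    ∫ z, f (inner ℝ u z) ∂(stdGaussian E) = ∫ a, f a ∂(gaussianReal 0 1) := by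
  rw [← stdGaussian_map_inner u hu, integral_map (by fun_prop) hf.aestronglyMeasurable]

theorem integral_stdGaussian_inner_mul (u v : E) (hu : ‖u‖ = 1) (hv : ‖v‖ = 1)
    {f g : ℝ → ℝ} (hf : Continuous f) (hg : Continuous g) {B C : ℝ}
    (hB : ∀ a, |f a| ≤ B) (hC : ∀ a, |g a| ≤ C) :
    ∫ z, f (inner ℝ u z) * g (inner ℝ v z) ∂(stdGaussian E)
      = ∫ a, f a * ∫ b, g (inner ℝ u v * a + √(1 - (inner ℝ u v) ^ 2) * b)
          ∂(gaussianReal 0 1) ∂(gaussianReal 0 1) := by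
  have hc : Continuous fun p : ℝ × ℝ => f p.1 * g p.2 := by fun_prop
  have h := integral_map (μ := stdGaussian E)
    (φ := fun z => ((inner ℝ u z : ℝ), (inner ℝ v z : ℝ))) (by fun_prop)
    (f := fun p : ℝ × ℝ => f p.1 * g p.2) hc.aestronglyMeasurable
  rw [← h, stdGaussian_map_inner_prod u v hu hv, integral_map (by fun_prop)
    hc.aestronglyMeasurable, integral_prod]
  · simp_rw [integral_const_mul]
  · refine Integrable.of_bound (C := B * C) ?_ (Filter.Eventually.of_forall fun p => ?_)
    · exact Continuous.aestronglyMeasurable (by fun_prop)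
    · simp only [Real.norm_eq_abs, abs_mul]
      exact mul_le_mul (hB _) (hC _) (abs_nonneg _) ((abs_nonneg _).trans (hB 0))

end GaussianLaws

/-- The masses of the atoms of the Bernoulli-Rademacher law. -/
noncomputable def atomMass (ρ : ℝ) : Fin 3 → ℝ := ![ρ / 2, ρ / 2, 1 - ρ]

/-- The atoms of the Bernoulli-Rademacher law. -/
noncomputable def atomSite (ρ : ℝ) : Fin 3 → ℝ := ![1 / √ρ, -(1 / √ρ), 0]

/-- The relative density of a planted sample, as a function of the coordinate in the hidden
direction. -/
noncomputable def profile (ρ σ a : ℝ) : ℝ :=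
  ∑ i, atomMass ρ i * shiftRatio σ (atomSite ρ i) a

/-- The `L²` inner product of the relative densities of one planted sample in two hidden
directions of inner product `t`, where `r = 1 - σ²`. -/
noncomputable def overlap (ρ r t : ℝ) : ℝ :=
  ∑ i, ∑ j, atomMass ρ i * atomMass ρ j * mehler r t (atomSite ρ i) (atomSite ρ j)

theorem relDensity_eq_profile {d : ℕ} {ρ σ : ℝ} (h0 : 0 ≤ ρ) (h1 : ρ ≤ 1) (hσ : 0 < σ)
    (u z : EuclideanSpace ℝ (Fin d)) (hu : ‖u‖ = 1) :
    relDensity ρ σ u z = profile ρ σ (inner ℝ u z) := by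
  rw [relDensity_eq hσ u z hu, integral_bernoulliRademacher h0 h1, profile]
  simp [Fin.sum_univ_three, atomMass, atomSite]

theorem continuous_profile (ρ σ : ℝ) : Continuous (profile ρ σ) :=
  continuous_finsetSum _ fun _ _ => continuous_const.mul (continuous_shiftRatio _ _)

theorem sum_atomMass (ρ : ℝ) : ∑ i, atomMass ρ i = 1 := by
  simp only [Fin.sum_univ_three, atomMass, Matrix.cons_val]
  ring

theorem exists_shiftRatio_bound {σ : ℝ} (hσ : 0 < σ) (hσ1 : σ < 1) (x : ℝ) :
    ∃ B, ∀ a, |shiftRatio σ x a| ≤ B :=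
  ⟨_, fun a => by
    rw [abs_of_nonneg (shiftRatio_nonneg hσ x a)]
    exact shiftRatio_le hσ hσ1 x a⟩

theorem exists_profile_bound (ρ : ℝ) {σ : ℝ} (hσ : 0 < σ) (hσ1 : σ < 1) :
    ∃ B, ∀ a, |profile ρ σ a| ≤ B := by
  choose B hB using exists_shiftRatio_bound hσ hσ1
  refine ⟨∑ i, |atomMass ρ i| * B (atomSite ρ i), fun a => ?_⟩
  refine (Finset.abs_sum_le_sum_abs _ _).trans (Finset.sum_le_sum fun i _ => ?_)
  rw [abs_mul]
  exact mul_le_mul_of_nonneg_left (hB _ _) (abs_nonneg _)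

theorem integral_profile (ρ : ℝ) {σ : ℝ} (hσ : 0 < σ) (hσ1 : σ < 1) :
    ∫ a, profile ρ σ a ∂(gaussianReal 0 1) = 1 := by
  unfold profile
  rw [integral_finsetSum]
  · simp_rw [integral_const_mul, integral_shiftRatio hσ, mul_one, sum_atomMass]
  · intro i _
    obtain ⟨B, hB⟩ := exists_shiftRatio_bound hσ hσ1 (atomSite ρ i)
    exact (Integrable.of_bound (continuous_shiftRatio _ _).aestronglyMeasurable B
      (Filter.Eventually.of_forall hB)).const_mul _

theorem integral_profile_mul {d : ℕ} (ρ : ℝ) {σ : ℝ} (hσ : 0 < σ) (hσ1 : σ < 1)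
    (u v : EuclideanSpace ℝ (Fin d)) (hu : ‖u‖ = 1) (hv : ‖v‖ = 1) :
    ∫ z, profile ρ σ (inner ℝ u z) * profile ρ σ (inner ℝ v z)
        ∂(stdGaussian (EuclideanSpace ℝ (Fin d)))
      = overlap ρ (1 - σ ^ 2) (inner ℝ u v) := by
  choose B hB using exists_shiftRatio_bound hσ hσ1
  have ht1 : (inner ℝ u v : ℝ) ^ 2 ≤ 1 := by
    have := abs_real_inner_le_norm u v
    rw [hu, hv, one_mul] at this
    rw [← sq_abs]
    exact pow_le_one₀ (abs_nonneg _) this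
  have h : ∀ z : EuclideanSpace ℝ (Fin d),
      profile ρ σ (inner ℝ u z) * profile ρ σ (inner ℝ v z)
      = ∑ i, ∑ j, (atomMass ρ i * atomMass ρ j) *
        (shiftRatio σ (atomSite ρ i) (inner ℝ u z) *
          shiftRatio σ (atomSite ρ j) (inner ℝ v z)) := by
    intro z
    rw [profile, profile, Finset.sum_mul_sum]
    refine Finset.sum_congr rfl fun i _ => Finset.sum_congr rfl fun j _ => ?_
    ring
  have hi : ∀ i j, Integrable (fun z : EuclideanSpace ℝ (Fin d) =>
      (atomMass ρ i * atomMass ρ j) *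
        (shiftRatio σ (atomSite ρ i) (inner ℝ u z) *
          shiftRatio σ (atomSite ρ j) (inner ℝ v z)))
      (stdGaussian (EuclideanSpace ℝ (Fin d))) := by
    intro i j
    refine Integrable.const_mul (Integrable.of_bound
      (C := B (atomSite ρ i) * B (atomSite ρ j)) ?_ (Filter.Eventually.of_forall fun p => ?_)) _
    · have h1 := continuous_shiftRatio σ (atomSite ρ i)
      have h2 := continuous_shiftRatio σ (atomSite ρ j)
      exact Continuous.aestronglyMeasurable (by fun_prop)
    · rw [Real.norm_eq_abs, abs_mul]
      exact mul_le_mul (hB _ _) (hB _ _) (abs_nonneg _) ((abs_nonneg _).trans (hB _ 0))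
  simp_rw [h]
  rw [integral_finsetSum _ fun i _ => integrable_finsetSum _ fun j _ => hi i j, overlap]
  refine Finset.sum_congr rfl fun i _ => ?_
  rw [integral_finsetSum _ fun j _ => hi i j]
  refine Finset.sum_congr rfl fun j _ => ?_
  rw [integral_const_mul, integral_stdGaussian_inner_mul u v hu hv (continuous_shiftRatio _ _)
    (continuous_shiftRatio _ _) (hB _) (hB _), integral_shiftRatio_mul hσ hσ1 ht1]

/-! ### Uniform points of the sphere and Gaussian vectors -/

section Polar

variable {E : Type*} [NormedAddCommGroup E] [InnerProductSpace ℝ E] [FiniteDimensional ℝ E]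
  [MeasurableSpace E] [BorelSpace E]

variable (E) in
/-- The value of the normalizing constant plays no role in the polar decomposition. -/
theorem stdGaussian_eq_withDensity :
    ∃ c : ℝ, stdGaussian E = (volume : Measure E).withDensity
      (fun x => ENNReal.ofReal (c * Real.exp (-(1 / 2) * ‖x‖ ^ 2))) := by
  obtain ⟨I, hI⟩ : ∃ I : ℝ, I = ∫ x : E, Real.exp (-(1 / 2) * ‖x‖ ^ 2) := ⟨_, rfl⟩
  have hI' : I = (Real.pi / (1 / 2)) ^ (Module.finrank ℝ E / 2 : ℝ) := by
    rw [hI]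
    exact GaussianFourier.integral_rexp_neg_mul_sq_norm (by norm_num)
  have hI0 : 0 < I := by rw [hI']; positivity
  have hIc : ((I : ℝ) : ℂ) = (Real.pi / ((1 / 2 : ℝ) : ℂ)) ^ (Module.finrank ℝ E / 2 : ℂ) := by
    rw [hI', Complex.ofReal_cpow (by positivity)]
    push_cast
    rfl
  have hint : Integrable (fun x : E => Real.exp (-(1 / 2) * ‖x‖ ^ 2)) := by
    by_contra h
    rw [integral_undef h] at hI
    exact hI0.ne' hI
  have hm : Measurable fun x : E => ENNReal.ofReal (I⁻¹ * Real.exp (-(1 / 2) * ‖x‖ ^ 2)) := by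
    fun_prop
  refine ⟨I⁻¹, ?_⟩
  have : IsFiniteMeasure ((volume : Measure E).withDensity
      (fun x => ENNReal.ofReal (I⁻¹ * Real.exp (-(1 / 2) * ‖x‖ ^ 2)))) :=
    isFiniteMeasure_withDensity_ofReal (hint.const_mul _).2
  apply Measure.ext_of_charFun
  ext t
  rw [charFun_stdGaussian, charFun_apply,
    integral_withDensity_eq_integral_toReal_smul hm (by simp)]
  have h : ∀ x : E, (ENNReal.ofReal (I⁻¹ * Real.exp (-(1 / 2) * ‖x‖ ^ 2))).toReal •
      Complex.exp ((inner ℝ x t : ℝ) * Complex.I)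
      = (I : ℂ)⁻¹ * Complex.exp (-((1 / 2 : ℝ) : ℂ) * ‖x‖ ^ 2
        + Complex.I * (inner ℝ t x : ℝ)) := by
    intro x
    rw [ENNReal.toReal_ofReal (by positivity), Complex.real_smul, real_inner_comm]
    push_cast
    rw [mul_assoc, ← Complex.exp_add]
    ring_nf
  simp_rw [h]
  rw [integral_const_mul, GaussianFourier.integral_cexp_neg_mul_sq_norm_add (by norm_num), ← hIc,
    ← mul_assoc, inv_mul_cancel₀ (by exact_mod_cast hI0.ne'), one_mul, Complex.I_sq]
  congr 1
  push_cast
  ring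

/-- Polar decomposition of the standard Gaussian law; the constant `C`, which depends only on `ψ`,
is the radial integral. -/
theorem lintegral_polar_toSphere [Nontrivial E] {ψ : ℝ → ℝ≥0∞} (hψ : Measurable ψ) :
    ∃ C : ℝ≥0∞, ∀ Φ : E → ℝ≥0∞, Measurable Φ →
      ∫⁻ x, Φ (‖x‖⁻¹ • x) * ψ ‖x‖ ∂(stdGaussian E)
        = (∫⁻ u, Φ (u : E) ∂((volume : Measure E).toSphere)) * C := by
  obtain ⟨c, hc⟩ := stdGaussian_eq_withDensity E
  have hw : Measurable fun r : ℝ => ENNReal.ofReal (c * Real.exp (-(1 / 2) * r ^ 2)) := by fun_prop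
  refine ⟨∫⁻ r : Set.Ioi (0 : ℝ), ψ r * ENNReal.ofReal (c * Real.exp (-(1 / 2) * (r : ℝ) ^ 2))
    ∂(Measure.volumeIoiPow (Module.finrank ℝ E - 1)), fun Φ hΦ => ?_⟩
  have hdir : Measurable fun x : E => ‖x‖⁻¹ • x := by fun_prop
  have hF : Measurable fun x : E => Φ (‖x‖⁻¹ • x) * ψ ‖x‖ :=
    (hΦ.comp hdir).mul (hψ.comp measurable_norm)
  rw [hc, lintegral_withDensity_eq_lintegral_mul _ (by fun_prop) hF]
  have h1 : ∀ F : E → ℝ≥0∞, ∫⁻ x, F x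
      = ∫⁻ x : ({0}ᶜ : Set E), F x ∂((volume : Measure E).comap (↑)) := by
    intro F
    rw [lintegral_subtype_comap (measurableSet_singleton _).compl, restrict_compl_singleton]
  have h2 := (volume : Measure E).measurePreserving_homeomorphUnitSphereProd.lintegral_comp_emb
    (Homeomorph.measurableEmbedding _)
    (fun p => Φ (p.1 : E) * (ψ p.2 * ENNReal.ofReal (c * Real.exp (-(1 / 2) * (p.2 : ℝ) ^ 2))))
  rw [h1, ← lintegral_prod_mul, ← h2]
  · refine lintegral_congr fun x => ?_
    simp only [Pi.mul_apply, homeomorphUnitSphereProd_apply_fst_coe,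
      homeomorphUnitSphereProd_apply_snd_coe]
    ring
  · exact (hΦ.comp measurable_subtype_coe).aemeasurable
  · exact ((hψ.mul hw).comp measurable_subtype_coe).aemeasurable

end Polar

instance isProbabilityMeasure_uniformSphere (d : ℕ) [NeZero d] :
    IsProbabilityMeasure (uniformSphere d) := by
  have : Nontrivial (EuclideanSpace ℝ (Fin d)) := by
    rw [← Module.finrank_pos_iff (R := ℝ), finrank_euclideanSpace_fin]
    exact Nat.pos_of_ne_zero (NeZero.ne d)
  constructor
  rw [uniformSphere, Measure.smul_apply, smul_eq_mul]
  refine ENNReal.inv_mul_cancel ?_ (measure_ne_top _ _)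
  rw [Ne, Measure.measure_univ_eq_zero]
  exact Measure.toSphere_ne_zero _

/-- Under the standard Gaussian law the direction of a vector is uniform on the sphere and
independent of the norm. -/
theorem lintegral_polar {d : ℕ} [NeZero d] {Φ : EuclideanSpace ℝ (Fin d) → ℝ≥0∞} {ψ : ℝ → ℝ≥0∞}
    (hΦ : Measurable Φ) (hψ : Measurable ψ) :
    ∫⁻ x, Φ (‖x‖⁻¹ • x) * ψ ‖x‖ ∂(stdGaussian (EuclideanSpace ℝ (Fin d)))
      = (∫⁻ u, Φ (u : EuclideanSpace ℝ (Fin d)) ∂(uniformSphere d)) *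
        ∫⁻ x, ψ ‖x‖ ∂(stdGaussian (EuclideanSpace ℝ (Fin d))) := by
  have : Nontrivial (EuclideanSpace ℝ (Fin d)) := by
    rw [← Module.finrank_pos_iff (R := ℝ), finrank_euclideanSpace_fin]
    exact Nat.pos_of_ne_zero (NeZero.ne d)
  obtain ⟨C, hC⟩ := lintegral_polar_toSphere (E := EuclideanSpace ℝ (Fin d)) hψ
  have h1 := hC (fun _ => 1) measurable_const
  simp only [one_mul, lintegral_one] at h1
  rw [hC Φ hΦ, h1, uniformSphere, lintegral_smul_measure, smul_eq_mul, ← mul_assoc]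
  congr 1
  rw [mul_comm, ← mul_assoc, ENNReal.mul_inv_cancel, one_mul]
  · rw [Ne, Measure.measure_univ_eq_zero]
    exact Measure.toSphere_ne_zero _
  · exact measure_ne_top _ _

/-- A standard Gaussian vector of `ℝ^d` has norm at least `√d / 2` with probability at least
`1 / 2`. -/
theorem half_le_stdGaussian_norm {d : ℕ} (hd : 4 ≤ d) :
    1 / 2 ≤ stdGaussian (EuclideanSpace ℝ (Fin d)) {x | √d / 2 ≤ ‖x‖} := by
  -- Markov's inequality for `exp (-‖x‖²)`, whose mean is `3 ^ (-d/2)`.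
  have hE : ∫ x : EuclideanSpace ℝ (Fin d), Real.exp (-‖x‖ ^ 2) ∂(stdGaussian _)
      = (√3)⁻¹ ^ d := by
    rw [← map_pi_eq_stdGaussian, integral_map (by fun_prop)
      (Continuous.aestronglyMeasurable (by fun_prop))]
    have h : ∀ x : Fin d → ℝ, Real.exp (-‖WithLp.toLp 2 x‖ ^ 2)
        = ∏ i, Real.exp (-(2 * x i ^ 2) / 2 + 0 * x i + 0) := by
      intro x
      rw [EuclideanSpace.real_norm_sq_eq, ← Real.exp_sum, ← Finset.sum_neg_distrib]
      congr 1
      refine Finset.sum_congr rfl fun i _ => ?_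
      ring
    simp_rw [h]
    rw [integral_fintype_prod_eq_prod
      (f := fun _ (a : ℝ) => Real.exp (-(2 * a ^ 2) / 2 + 0 * a + 0))]
    simp_rw [integral_exp_quadratic_gaussianReal 2 0 0 (by norm_num)]
    simp
    norm_num
  have hint : Integrable (fun x : EuclideanSpace ℝ (Fin d) => Real.exp (-‖x‖ ^ 2))
      (stdGaussian _) := by
    by_contra h
    rw [integral_undef h] at hE
    have : 0 < (√3)⁻¹ ^ d := by positivity
    linarith
  have hM := mul_meas_ge_le_integral_of_nonneg (μ := stdGaussian (EuclideanSpace ℝ (Fin d)))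
    (f := fun x => Real.exp (-‖x‖ ^ 2)) (Filter.Eventually.of_forall fun x => by positivity) hint
    (Real.exp (-(d / 4 : ℝ)))
  rw [hE] at hM
  have hnum : (√3)⁻¹ ^ d * Real.exp (d / 4 : ℝ) ≤ 1 / 2 := by
    have h1 : Real.exp (d / 4 : ℝ) = Real.exp (1 / 4) ^ d := by
      rw [← Real.exp_nat_mul]
      ring_nf
    rw [h1, ← mul_pow]
    have h4 : ((√3)⁻¹ * Real.exp (1 / 4)) ^ 4 ≤ 1 / 2 := by
      have ha : (√3) ^ 4 = 9 := by
        rw [show (√3) ^ 4 = ((√3) ^ 2) ^ 2 by ring, Real.sq_sqrt (by norm_num)]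
        norm_num
      have hb : Real.exp (1 / 4) ^ 4 = Real.exp 1 := by
        rw [← Real.exp_nat_mul]
        norm_num
      rw [mul_pow, inv_pow, ha, hb]
      have := Real.exp_one_lt_d9
      linarith
    have h5 : (√3)⁻¹ * Real.exp (1 / 4) ≤ 1 := by
      by_contra h
      have := one_lt_pow₀ (not_le.1 h) (n := 4) (by norm_num)
      linarith
    exact (pow_le_pow_of_le_one (by positivity) h5 hd).trans h4
  have hsmall : (stdGaussian (EuclideanSpace ℝ (Fin d))).real {x | √d / 2 ≤ ‖x‖}ᶜ ≤ 1 / 2 := by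
    have hsub : {x : EuclideanSpace ℝ (Fin d) | √d / 2 ≤ ‖x‖}ᶜ
        ⊆ {x | Real.exp (-(d / 4 : ℝ)) ≤ Real.exp (-‖x‖ ^ 2)} := by
      intro x hx
      have hx' : ‖x‖ < √d / 2 := not_le.1 hx
      have h2 : ‖x‖ ^ 2 ≤ (√d / 2) ^ 2 := pow_le_pow_left₀ (norm_nonneg _) hx'.le 2
      rw [div_pow, Real.sq_sqrt (by positivity)] at h2
      refine Real.exp_le_exp.2 ?_
      linarith
    refine (measureReal_mono hsub).trans ?_
    have h6 : Real.exp (-(d / 4 : ℝ)) * Real.exp (d / 4 : ℝ) = 1 := by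
      rw [← Real.exp_add, neg_add_cancel, Real.exp_zero]
    calc _ = (Real.exp (-(d / 4 : ℝ)) * Real.exp (d / 4 : ℝ)) * _ := by rw [h6, one_mul]
      _ = (Real.exp (-(d / 4 : ℝ)) * (stdGaussian (EuclideanSpace ℝ (Fin d))).real
          {x | Real.exp (-(d / 4 : ℝ)) ≤ Real.exp (-‖x‖ ^ 2)}) * Real.exp (d / 4 : ℝ) := by ring
      _ ≤ (√3)⁻¹ ^ d * Real.exp (d / 4 : ℝ) :=
          mul_le_mul_of_nonneg_right hM (Real.exp_pos _).le
      _ ≤ 1 / 2 := hnum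
  have hms : MeasurableSet {x : EuclideanSpace ℝ (Fin d) | √d / 2 ≤ ‖x‖} :=
    measurableSet_le measurable_const measurable_norm
  rw [probReal_compl_eq_one_sub hms] at hsmall
  have h7 : (1 : ℝ) / 2 ≤ (stdGaussian (EuclideanSpace ℝ (Fin d))).real {x | √d / 2 ≤ ‖x‖} := by
    linarith
  have h8 := ENNReal.ofReal_le_ofReal h7
  rw [ofReal_measureReal] at h8
  refine le_trans (le_of_eq ?_) h8
  rw [ENNReal.ofReal_div_of_pos (by norm_num)]
  simp

/-- Up to a factor `2`, a coordinate of a uniform point of the sphere, scaled by `√d / 2`, is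
dominated by a standard Gaussian variable. -/
theorem integral_uniformSphere_le {d : ℕ} [NeZero d] (hd : 4 ≤ d) (v : EuclideanSpace ℝ (Fin d))
    (hv : ‖v‖ = 1) {f : ℝ → ℝ} (hf : Continuous f) (hf0 : ∀ x, 0 ≤ f x)
    (hmono : MonotoneOn f (Set.Ici 0)) (hint : Integrable (fun x => f |x|) (gaussianReal 0 1)) :
    ∫ u, f (√d / 2 * |inner ℝ (u : EuclideanSpace ℝ (Fin d)) v|) ∂(uniformSphere d)
      ≤ 2 * ∫ x, f |x| ∂(gaussianReal 0 1) := by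
  -- On `√d / 2 ≤ ‖x‖` the coordinate of `x` along `v` is at least `√d / 2` times that of its
  -- direction, in absolute value; this event is independent of the direction and has probability
  -- at least `1 / 2`.
  have h1 : ∫⁻ x, ENNReal.ofReal (f (√d / 2 * |inner ℝ (‖x‖⁻¹ • x) v|)) *
        Set.indicator (Set.Ici (√d / 2)) 1 ‖x‖ ∂(stdGaussian (EuclideanSpace ℝ (Fin d)))
      ≤ ENNReal.ofReal (∫ x, f |x| ∂(gaussianReal 0 1)) := by
    rw [ofReal_integral_eq_lintegral_ofReal hint (Filter.Eventually.of_forall fun x => hf0 _),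
      ← stdGaussian_map_inner v hv, lintegral_map (by fun_prop) (by fun_prop)]
    refine lintegral_mono fun x => ?_
    by_cases hx : ‖x‖ ∈ Set.Ici (√d / 2)
    · rw [Set.indicator_of_mem hx, Pi.one_apply, mul_one]
      have hx' : √d / 2 ≤ ‖x‖ := hx
      refine ENNReal.ofReal_le_ofReal (hmono (Set.mem_Ici.2 (by positivity))
        (Set.mem_Ici.2 (abs_nonneg _)) ?_)
      have h0 : 0 < √d / 2 := by
        have : (0 : ℝ) < d := by exact_mod_cast (by omega : 0 < d)
        positivity
      rw [inner_smul_left, abs_mul, real_inner_comm]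
      simp only [conj_trivial, abs_inv, abs_norm]
      have hn : 0 < ‖x‖ := h0.trans_le hx'
      calc √d / 2 * (‖x‖⁻¹ * |inner ℝ v x|) ≤ ‖x‖ * (‖x‖⁻¹ * |inner ℝ v x|) := by gcongr
        _ = |inner ℝ v x| := by rw [← mul_assoc, mul_inv_cancel₀ hn.ne', one_mul]
    · rw [Set.indicator_of_notMem hx, mul_zero]
      exact zero_le
  have hΦ : Measurable fun x : EuclideanSpace ℝ (Fin d) =>
      ENNReal.ofReal (f (√d / 2 * |inner ℝ x v|)) := by fun_prop
  have hψ : Measurable (Set.indicator (Set.Ici (√d / 2)) (1 : ℝ → ℝ≥0∞)) :=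
    measurable_one.indicator measurableSet_Ici
  rw [lintegral_polar hΦ hψ] at h1
  have h2 : ∫⁻ x : EuclideanSpace ℝ (Fin d), Set.indicator (Set.Ici (√d / 2)) (1 : ℝ → ℝ≥0∞) ‖x‖
      ∂(stdGaussian (EuclideanSpace ℝ (Fin d)))
      = stdGaussian (EuclideanSpace ℝ (Fin d)) {x | √d / 2 ≤ ‖x‖} := by
    rw [← lintegral_indicator_one (measurableSet_le measurable_const measurable_norm)]
    rfl
  have hcu : Continuous fun u : UnitSphere d =>
      f (√d / 2 * |inner ℝ (u : EuclideanSpace ℝ (Fin d)) v|) := by fun_prop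
  have hiu : Integrable (fun u : UnitSphere d =>
      f (√d / 2 * |inner ℝ (u : EuclideanSpace ℝ (Fin d)) v|)) (uniformSphere d) :=
    hcu.integrable_of_hasCompactSupport (HasCompactSupport.of_compactSpace _)
  have h3 : (ENNReal.ofReal (∫ u, f (√d / 2 * |inner ℝ (u : EuclideanSpace ℝ (Fin d)) v|)
      ∂(uniformSphere d))) * (1 / 2) ≤ ENNReal.ofReal (∫ x, f |x| ∂(gaussianReal 0 1)) := by
    refine le_trans ?_ h1
    rw [ofReal_integral_eq_lintegral_ofReal hiu (Filter.Eventually.of_forall fun x => hf0 _)]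
    refine mul_le_mul' le_rfl ?_
    refine (half_le_stdGaussian_norm hd).trans (le_of_eq h2.symm)
  have h4 : (1 / 2 : ℝ≥0∞) = ENNReal.ofReal (1 / 2) := by
    rw [ENNReal.ofReal_div_of_pos (by norm_num)]
    simp
  have h5 : 0 ≤ ∫ x, f |x| ∂(gaussianReal 0 1) := integral_nonneg fun x => hf0 _
  rw [h4, ← ENNReal.ofReal_mul (integral_nonneg fun x => hf0 _),
    ENNReal.ofReal_le_ofReal_iff h5] at h3
  linarith

/-! ### Moments of a coordinate of a uniform point of the sphere -/

theorem integrable_exp_mul_abs_gaussianReal (c : ℝ) :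
    Integrable (fun x : ℝ => Real.exp (c * |x|)) (gaussianReal 0 1) := by
  refine Integrable.mono' ((integrable_exp_mul_gaussianReal c).add
    (integrable_exp_mul_gaussianReal (-c))) (Continuous.aestronglyMeasurable (by fun_prop))
    (Filter.Eventually.of_forall fun x => ?_)
  rw [Real.norm_eq_abs, abs_of_nonneg (Real.exp_pos _).le]
  simp only [Pi.add_apply]
  rcases abs_cases x with h | h <;> rw [h.1]
  · linarith [Real.exp_pos (-c * x)]
  · rw [mul_neg, ← neg_mul]
    linarith [Real.exp_pos (c * x)]

theorem integral_exp_mul_abs_gaussianReal_le (c : ℝ) :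
    ∫ x, Real.exp (c * |x|) ∂(gaussianReal 0 1) ≤ 2 * Real.exp (c ^ 2 / 2) := by
  have h : ∀ c : ℝ, ∫ x, Real.exp (c * x) ∂(gaussianReal 0 1) = Real.exp (c ^ 2 / 2) := by
    intro c
    have := congrFun (mgf_id_gaussianReal (μ := 0) (v := 1)) c
    simpa [mgf] using this
  calc ∫ x, Real.exp (c * |x|) ∂(gaussianReal 0 1)
      ≤ ∫ x, (Real.exp (c * x) + Real.exp (-c * x)) ∂(gaussianReal 0 1) := by
        refine integral_mono (integrable_exp_mul_abs_gaussianReal c)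
          ((integrable_exp_mul_gaussianReal c).add (integrable_exp_mul_gaussianReal (-c)))
          fun x => ?_
        rcases abs_cases x with h | h <;> simp only [h.1]
        · linarith [Real.exp_pos (-c * x)]
        · rw [mul_neg, ← neg_mul]
          linarith [Real.exp_pos (c * x)]
    _ = 2 * Real.exp (c ^ 2 / 2) := by
        rw [integral_add (integrable_exp_mul_gaussianReal c)
          (integrable_exp_mul_gaussianReal (-c)), h, h, neg_sq]
        ring

theorem abs_pow_le_factorial_mul_exp (N : ℕ) (x : ℝ) :
    |x| ^ N ≤ N.factorial * Real.exp (1 * |x|) := by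
  have := Real.pow_div_factorial_le_exp |x| (abs_nonneg _) N
  rw [div_le_iff₀ (by positivity)] at this
  rw [one_mul]
  linarith

theorem integrable_abs_pow_gaussianReal (N : ℕ) :
    Integrable (fun x : ℝ => |x| ^ N) (gaussianReal 0 1) := by
  refine Integrable.mono' ((integrable_exp_mul_abs_gaussianReal 1).const_mul (N.factorial : ℝ))
    (Continuous.aestronglyMeasurable (by fun_prop)) (Filter.Eventually.of_forall fun x => ?_)
  rw [Real.norm_eq_abs, abs_of_nonneg (by positivity)]
  exact abs_pow_le_factorial_mul_exp N x

theorem integral_abs_pow_gaussianReal_le (N : ℕ) :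
    ∫ x, |x| ^ N ∂(gaussianReal 0 1) ≤ 4 * N.factorial := by
  calc ∫ x, |x| ^ N ∂(gaussianReal 0 1)
      ≤ ∫ x, N.factorial * Real.exp (1 * |x|) ∂(gaussianReal 0 1) :=
        integral_mono (integrable_abs_pow_gaussianReal N)
          ((integrable_exp_mul_abs_gaussianReal 1).const_mul _)
          fun x => abs_pow_le_factorial_mul_exp N x
    _ ≤ N.factorial * (2 * Real.exp (1 ^ 2 / 2)) := by
        rw [integral_const_mul]
        gcongr
        exact integral_exp_mul_abs_gaussianReal_le 1
    _ ≤ 4 * N.factorial := by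
        have h1 : Real.exp (1 ^ 2 / 2) ≤ 2 := by
          have h2 : Real.exp (1 ^ 2 / 2) ^ 2 = Real.exp 1 := by
            rw [← Real.exp_nat_mul]
            norm_num
          have := Real.exp_one_lt_d9
          nlinarith [Real.exp_pos ((1 : ℝ) ^ 2 / 2)]
        have h3 : (0 : ℝ) ≤ N.factorial := by positivity
        nlinarith

theorem integral_uniformSphere_abs_pow_le {d : ℕ} [NeZero d] (hd : 4 ≤ d)
    (v : EuclideanSpace ℝ (Fin d)) (hv : ‖v‖ = 1) (N : ℕ) :
    ∫ u, |inner ℝ (u : EuclideanSpace ℝ (Fin d)) v| ^ N ∂(uniformSphere d)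
      ≤ 8 * N.factorial * (2 / √d) ^ N := by
  have h := integral_uniformSphere_le hd v hv (f := fun x => |x| ^ N) (by fun_prop)
    (fun x => by positivity)
    (fun x hx y _ hxy => pow_le_pow_left₀ (abs_nonneg _)
      (abs_le_abs_of_nonneg hx hxy) N)
    (by simpa using integrable_abs_pow_gaussianReal N)
  have hd0 : (0 : ℝ) < d := by exact_mod_cast (by omega : 0 < d)
  simp only [abs_abs, abs_mul, mul_pow] at h
  rw [integral_const_mul, abs_of_nonneg (by positivity)] at h
  have h2 := integral_abs_pow_gaussianReal_le N
  have h3 : (2 / √d) ^ N * (√d / 2) ^ N = 1 := by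
    rw [← mul_pow, show 2 / √d * (√d / 2) = 1 by
      have : √(d : ℝ) ≠ 0 := by positivity
      field_simp, one_pow]
  have h4 : 0 < (2 / √(d : ℝ)) ^ N := by positivity
  calc _ = (2 / √d) ^ N * ((√d / 2) ^ N *
        ∫ u, |inner ℝ (u : EuclideanSpace ℝ (Fin d)) v| ^ N ∂(uniformSphere d)) := by
        rw [← mul_assoc, h3, one_mul]
    _ ≤ (2 / √d) ^ N * (2 * (4 * N.factorial)) := by
        refine mul_le_mul_of_nonneg_left (h.trans ?_) h4.le
        linarith
    _ = _ := by ring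

theorem integral_uniformSphere_exp_abs_le {d : ℕ} [NeZero d] (hd : 4 ≤ d)
    (v : EuclideanSpace ℝ (Fin d)) (hv : ‖v‖ = 1) {c : ℝ} (hc : 0 ≤ c) :
    ∫ u, Real.exp (c * (√d * |inner ℝ (u : EuclideanSpace ℝ (Fin d)) v|)) ∂(uniformSphere d)
      ≤ 4 * Real.exp (2 * c ^ 2) := by
  have h := integral_uniformSphere_le hd v hv (f := fun x => Real.exp (2 * c * x)) (by fun_prop)
    (fun x => by positivity)
    (fun x _ y _ hxy => Real.exp_le_exp.2 (by gcongr))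
    (integrable_exp_mul_abs_gaussianReal (2 * c))
  have h2 := integral_exp_mul_abs_gaussianReal_le (2 * c)
  have h3 : ∀ a : ℝ, 2 * c * (√d / 2 * a) = c * (√d * a) := fun a => by ring
  simp only [h3] at h
  refine h.trans ?_
  rw [show (2 * c) ^ 2 / 2 = 2 * c ^ 2 by ring] at h2
  linarith

theorem integrable_inv_sqrt_abs_gaussianReal :
    Integrable (fun x : ℝ => (√|x|)⁻¹) (gaussianReal 0 1) := by
  rw [gaussianReal_of_var_ne_zero 0 one_ne_zero,
    integrable_withDensity_iff_integrable_smul' (measurable_gaussianPDF _ _)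
      (Filter.Eventually.of_forall fun _ => gaussianPDF_lt_top)]
  have h := (integrable_fun_norm_addHaar (volume : Measure ℝ)
    (f := fun y : ℝ => (√(2 * Real.pi))⁻¹ * (y ^ (-(1 / 2) : ℝ) *
      Real.exp (-(1 / 2) * y ^ 2)))).2 (by
      simp only [Module.finrank_self, Nat.sub_self, pow_zero, one_smul]
      exact (integrableOn_rpow_mul_exp_neg_mul_sq (b := 1 / 2) (by norm_num)
        (s := -(1 / 2)) (by norm_num)).const_mul _)
  refine h.congr (Filter.Eventually.of_forall fun x => ?_)
  simp only [Real.norm_eq_abs, toReal_gaussianPDF, gaussianPDFReal, smul_eq_mul, sq_abs]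
  rw [Real.rpow_neg (abs_nonneg _), ← Real.sqrt_eq_rpow]
  simp only [NNReal.coe_one, mul_one, sub_zero]
  rw [show -x ^ 2 / 2 = -(1 / 2) * x ^ 2 by ring]
  ring

/-! ### Negative moments on the sphere -/

/-- The mean of `|x| ^ (-1/2)` under the standard Gaussian law. -/
noncomputable def invSqrtMoment : ℝ := ∫ x, (√|x|)⁻¹ ∂(gaussianReal 0 1)

theorem invSqrtMoment_nonneg : 0 ≤ invSqrtMoment :=
  integral_nonneg fun x => by positivity

/-- A lower bound of the power `S ^ k` of a sum of squares by a product of independent factors; the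
exponent `1 / 2` keeps the inverse of each factor integrable at `0`. -/
theorem prod_sqrt_abs_le {ι : Type*} (I : Finset ι) {k : ℕ} (hI : I.card = 4 * k) (y : ι → ℝ)
    {S : ℝ} (hS0 : 0 ≤ S) (hS : ∀ i ∈ I, y i ^ 2 ≤ S) : ∏ i ∈ I, √|y i| ≤ S ^ k := by
  calc ∏ i ∈ I, √|y i| ≤ ∏ _i ∈ I, √√S := by
        refine Finset.prod_le_prod (fun i _ => by positivity) fun i hi => ?_
        exact Real.sqrt_le_sqrt (Real.abs_le_sqrt (hS i hi))
    _ = S ^ k := by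
        rw [Finset.prod_const, hI, pow_mul, show (√√S) ^ 4 = ((√√S) ^ 2) ^ 2 by ring,
          Real.sq_sqrt (Real.sqrt_nonneg _), Real.sq_sqrt hS0]

/-- Here `a` is a coordinate of a vector of norm `n`, and `S` is the sum of the squares of the
others. -/
theorem inv_one_sub_pow_le {r a n S : ℝ} {k : ℕ} (hr0 : 0 ≤ r) (hr1 : r ≤ 1) (hS : 0 < S)
    (hn0 : 0 < n) (hn : n ^ 2 = a ^ 2 + S) {P : ℝ} (hP0 : 0 < P) (hP : P ≤ S ^ k) :
    ((1 - (r * (n⁻¹ * a)) ^ 2)⁻¹) ^ k ≤ 2 ^ k * (1 + |a| ^ (2 * k) * P⁻¹) := by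
  have hr2 : r ^ 2 ≤ 1 := pow_le_one₀ hr0 hr1
  have h1 : S / n ^ 2 ≤ 1 - (r * (n⁻¹ * a)) ^ 2 := by
    have : (r * (n⁻¹ * a)) ^ 2 ≤ (n⁻¹ * a) ^ 2 := by
      rw [mul_pow]
      exact mul_le_of_le_one_left (sq_nonneg _) hr2
    have h2 : (n⁻¹ * a) ^ 2 + S / n ^ 2 = 1 := by
      rw [mul_pow, inv_pow]
      field_simp
      linarith
    linarith
  have h3 : (1 - (r * (n⁻¹ * a)) ^ 2)⁻¹ ≤ 1 + a ^ 2 / S := by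
    refine (inv_anti₀ (by positivity) h1).trans (le_of_eq ?_)
    rw [inv_div, hn]
    field_simp
    ring
  have h4 : 0 ≤ (1 - (r * (n⁻¹ * a)) ^ 2)⁻¹ := inv_nonneg.2 (le_trans (by positivity) h1)
  calc ((1 - (r * (n⁻¹ * a)) ^ 2)⁻¹) ^ k ≤ (1 + a ^ 2 / S) ^ k := pow_le_pow_left₀ h4 h3 k
    _ ≤ 2 ^ (k - 1) * (1 ^ k + (a ^ 2 / S) ^ k) := add_pow_le zero_le_one (by positivity) k
    _ ≤ 2 ^ k * (1 + |a| ^ (2 * k) * P⁻¹) := by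
        rw [one_pow, div_pow, pow_mul, sq_abs, div_eq_mul_inv]
        gcongr
        · norm_num
        · exact Nat.sub_le k 1

theorem one_sub_mul_inner_sq_pos {d : ℕ} (v : EuclideanSpace ℝ (Fin d)) (hv : ‖v‖ = 1) {r : ℝ}
    (hr0 : 0 ≤ r) (hr1 : r < 1) (u : UnitSphere d) :
    0 < 1 - (r * inner ℝ (u : EuclideanSpace ℝ (Fin d)) v) ^ 2 := by
  have h1 := abs_real_inner_le_norm (u : EuclideanSpace ℝ (Fin d)) v
  rw [hv, mul_one, norm_eq_of_mem_sphere] at h1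
  have h2 : |r * inner ℝ (u : EuclideanSpace ℝ (Fin d)) v| < 1 := by
    rw [abs_mul, abs_of_nonneg hr0]
    calc r * |inner ℝ (u : EuclideanSpace ℝ (Fin d)) v| ≤ r * 1 := by gcongr
      _ < 1 := by linarith
  have := (sq_lt_one_iff_abs_lt_one _).2 h2
  linarith

theorem integrable_inv_pow {d : ℕ} [NeZero d] (v : EuclideanSpace ℝ (Fin d)) (hv : ‖v‖ = 1) {r : ℝ}
    (hr0 : 0 ≤ r) (hr1 : r < 1) (k : ℕ) :
    Integrable (fun u : UnitSphere d =>
      ((1 - (r * inner ℝ (u : EuclideanSpace ℝ (Fin d)) v) ^ 2)⁻¹) ^ k) (uniformSphere d) := by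
  have hcu : Continuous fun u : UnitSphere d =>
      ((1 - (r * inner ℝ (u : EuclideanSpace ℝ (Fin d)) v) ^ 2)⁻¹) ^ k :=
    Continuous.pow (Continuous.inv₀ (by fun_prop) fun u =>
      (one_sub_mul_inner_sq_pos v hv hr0 hr1 u).ne') k
  exact hcu.integrable_of_hasCompactSupport (HasCompactSupport.of_compactSpace _)

/-- The negative moments of `1 - ⟨u, v⟩²` over the sphere, regularized by `r < 1`. In Gaussian
coordinates, `1 - ⟨u, v⟩²` is the proportion of the squared norm outside the first coordinate, and
the product of the square roots of `4 k` of the other coordinates bounds the `k`-th power of the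
sum of their squares from below. -/
theorem integral_uniformSphere_inv_pow_le {d k : ℕ} [NeZero d] (hk : 4 * k + 1 < d)
    (v : EuclideanSpace ℝ (Fin d)) (hv : ‖v‖ = 1) {r : ℝ} (hr0 : 0 ≤ r) (hr1 : r < 1) :
    ∫ u, ((1 - (r * inner ℝ (u : EuclideanSpace ℝ (Fin d)) v) ^ 2)⁻¹) ^ k ∂(uniformSphere d)
      ≤ 2 ^ k * (1 + 4 * (2 * k).factorial * invSqrtMoment ^ (4 * k)) := by
  classical
  obtain ⟨I, hI, hIc⟩ : ∃ I : Finset (Fin d), I ⊆ Finset.univ.erase 0 ∧ I.card = 4 * k :=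
    Finset.exists_subset_card_eq (by
      rw [Finset.card_erase_of_mem (Finset.mem_univ _), Finset.card_univ, Fintype.card_fin]
      omega)
  obtain ⟨b, hb⟩ : ∃ b : OrthonormalBasis (Fin d) ℝ (EuclideanSpace ℝ (Fin d)), b 0 = v := by
    have ho : Orthonormal ℝ (({0} : Set (Fin d)).domRestrict fun _ => v) := by
      rw [orthonormal_iff_ite]
      intro i j
      have : i = j := Subsingleton.elim _ _
      simp [this, Set.domRestrict, hv]
    obtain ⟨b, hb⟩ := ho.exists_orthonormalBasis_extension_of_card_eq (by simp)
    exact ⟨b, hb 0 rfl⟩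
  -- In an orthonormal basis that starts with `v`, the integrand is at most `2 ^ k (1 + ∏ i, f i)`.
  let f : Fin d → ℝ → ℝ := fun i x =>
    if i = 0 then |x| ^ (2 * k) else if i ∈ I then (√|x|)⁻¹ else 1
  have hf : ∀ i, Integrable (f i) (gaussianReal 0 1) := by
    intro i
    simp only [f]
    split_ifs
    · exact integrable_abs_pow_gaussianReal _
    · exact integrable_inv_sqrt_abs_gaussianReal
    · exact integrable_const _
  have hprod : ∀ y : Fin d → ℝ, ∏ i, f i (y i) = |y 0| ^ (2 * k) * (∏ i ∈ I, √|y i|)⁻¹ := by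
    intro y
    rw [← Finset.mul_prod_erase _ _ (Finset.mem_univ 0), ← Finset.prod_inv_distrib,
      ← Finset.prod_subset hI]
    · congr 1
      refine Finset.prod_congr rfl fun i hi => ?_
      simp [f, hi, Finset.ne_of_mem_erase (hI hi)]
    · intro i hi hi'
      simp [f, hi', Finset.ne_of_mem_erase hi]
  have hprodI : ∏ i, ∫ x, f i x ∂(gaussianReal 0 1)
      = (∫ x, |x| ^ (2 * k) ∂(gaussianReal 0 1)) * invSqrtMoment ^ (4 * k) := by
    rw [← Finset.mul_prod_erase _ _ (Finset.mem_univ 0), ← hIc, ← Finset.prod_const,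
      ← Finset.prod_subset hI]
    · congr 1
      refine Finset.prod_congr rfl fun i hi => ?_
      simp [f, hi, Finset.ne_of_mem_erase (hI hi), invSqrtMoment]
    · intro i hi hi'
      simp [f, hi', Finset.ne_of_mem_erase hi]
  have hint : Integrable (fun y : Fin d → ℝ => 2 ^ k * (1 + ∏ i, f i (y i)))
      (Measure.pi fun _ : Fin d => gaussianReal 0 1) :=
    ((integrable_const _).add (Integrable.fintype_prod hf)).const_mul _
  have hne : ∀ᵐ y : Fin d → ℝ ∂(Measure.pi fun _ : Fin d => gaussianReal 0 1),
      ∀ i, y i ≠ 0 := by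
    rw [ae_all_iff]
    intro i
    have h0 : ∀ᵐ x ∂(gaussianReal 0 1), x ≠ (0 : ℝ) := by
      have := nullSingletonClass_gaussianReal (μ := 0) (v := 1) one_ne_zero
      exact Measure.ae_ne _ 0
    exact (measurePreserving_eval (fun _ : Fin d => gaussianReal 0 1) i).quasiMeasurePreserving.ae
      h0
  have hpt : ∀ y : Fin d → ℝ, (∀ i, y i ≠ 0) →
      ((1 - (r * inner ℝ (‖∑ i, y i • b i‖⁻¹ • ∑ i, y i • b i) v) ^ 2)⁻¹) ^ k
        ≤ 2 ^ k * (1 + ∏ i, f i (y i)) := by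
    intro y hy
    have hin : inner ℝ (∑ i, y i • b i) v = y 0 := by
      rw [← hb, b.orthonormal.inner_left_fintype]
      simp
    have hnorm : ‖∑ i, y i • b i‖ ^ 2 = y 0 ^ 2 + ∑ i ∈ Finset.univ.erase 0, y i ^ 2 := by
      rw [Finset.add_sum_erase _ (fun i => y i ^ 2) (Finset.mem_univ 0),
        ← real_inner_self_eq_norm_sq, b.orthonormal.inner_sum]
      simp [sq]
    have hle : ∀ i ∈ Finset.univ.erase (0 : Fin d),
        y i ^ 2 ≤ ∑ i ∈ Finset.univ.erase 0, y i ^ 2 := fun i hi =>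
      Finset.single_le_sum (f := fun i => y i ^ 2) (fun _ _ => sq_nonneg _) hi
    have hS : 0 < ∑ i ∈ Finset.univ.erase 0, y i ^ 2 := by
      obtain ⟨i, hi⟩ : (Finset.univ.erase (0 : Fin d)).Nonempty := by
        rw [← Finset.card_pos, Finset.card_erase_of_mem (Finset.mem_univ _), Finset.card_univ,
          Fintype.card_fin]
        omega
      exact lt_of_lt_of_le (pow_pos (abs_pos.2 (hy i)) 2 |>.trans_eq (sq_abs _)) (hle i hi)
    have hn0 : 0 < ‖∑ i, y i • b i‖ := by
      refine lt_of_le_of_ne (norm_nonneg _) fun h => ?_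
      rw [← h] at hnorm
      nlinarith [sq_nonneg (y 0)]
    rw [inner_smul_left, hin, hprod]
    refine inv_one_sub_pow_le hr0 hr1.le hS hn0 hnorm ?_
      (prod_sqrt_abs_le I hIc y hS.le fun i hi => hle i (hI hi))
    exact Finset.prod_pos fun i _ => Real.sqrt_pos.2 (abs_pos.2 (hy i))
  have hmeas : Measurable fun x : EuclideanSpace ℝ (Fin d) =>
      ENNReal.ofReal (((1 - (r * inner ℝ x v) ^ 2)⁻¹) ^ k) := by fun_prop
  have hiu := integrable_inv_pow v hv hr0 hr1 k
  have hpolar := lintegral_polar hmeas (measurable_const (a := (1 : ℝ≥0∞)))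
  simp only [mul_one, lintegral_one, measure_univ] at hpolar
  have hnn : ∀ u : UnitSphere d,
      0 ≤ ((1 - (r * inner ℝ (u : EuclideanSpace ℝ (Fin d)) v) ^ 2)⁻¹) ^ k := fun u =>
    pow_nonneg (inv_nonneg.2 (one_sub_mul_inner_sq_pos v hv hr0 hr1 u).le) k
  have hrhs : ∫ y, 2 ^ k * (1 + ∏ i, f i (y i)) ∂(Measure.pi fun _ : Fin d => gaussianReal 0 1)
      ≤ 2 ^ k * (1 + 4 * (2 * k).factorial * invSqrtMoment ^ (4 * k)) := by
    rw [integral_const_mul, integral_add (integrable_const _) (Integrable.fintype_prod hf),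
      integral_fintype_prod_eq_prod, hprodI]
    simp only [integral_const, probReal_univ, smul_eq_mul, one_mul]
    have := integral_abs_pow_gaussianReal_le (2 * k)
    have h0 := pow_nonneg invSqrtMoment_nonneg (4 * k)
    gcongr
  have hnn0 : 0 ≤ᵐ[Measure.pi fun _ : Fin d => gaussianReal 0 1]
      fun y : Fin d → ℝ => 2 ^ k * (1 + ∏ i, f i (y i)) := by
    refine Filter.Eventually.of_forall fun y => ?_
    simp only [Pi.zero_apply]
    rw [hprod]
    positivity
  refine le_trans ?_ hrhs
  rw [← ENNReal.ofReal_le_ofReal_iff (integral_nonneg_of_ae hnn0),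
    ofReal_integral_eq_lintegral_ofReal hiu (Filter.Eventually.of_forall hnn), ← hpolar,
    ofReal_integral_eq_lintegral_ofReal hint hnn0, stdGaussian_eq_map_pi_orthonormalBasis b,
    lintegral_map (by fun_prop) (by fun_prop)]
  refine lintegral_mono_ae ?_
  filter_upwards [hne] with y hy
  exact ENNReal.ofReal_le_ofReal (hpt y hy)

/-! ### Mixtures of product densities -/

section Mixture

variable {U Ω : Type*}

/-- The sum over the sets `S` in `F` of the products over `i ∈ S` of `b u (z i)`. -/
def setSum {n : ℕ} (b : U → Ω → ℝ) (F : Finset (Finset (Fin n))) (u : U) (z : Fin n → Ω) : ℝ :=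
  ∑ S ∈ F, ∏ i ∈ S, b u (z i)

/-- The sets of at most `k` samples. -/
def smallSets (n k : ℕ) : Finset (Finset (Fin n)) := Finset.univ.filter fun S => S.card ≤ k

/-- The sets of more than `k` samples. -/
def largeSets (n k : ℕ) : Finset (Finset (Fin n)) := Finset.univ.filter fun S => ¬ S.card ≤ k

variable {n : ℕ} {b : U → Ω → ℝ} {M : ℝ}

theorem prod_one_add_eq_setSum (u : U) (z : Fin n → Ω) (k : ℕ) :
    ∏ i, (1 + b u (z i)) = setSum b (smallSets n k) u z + setSum b (largeSets n k) u z := by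
  rw [Finset.prod_one_add, setSum, setSum, smallSets, largeSets, Finset.powerset_univ,
    Finset.sum_filter_add_sum_filter_not]

theorem exists_setSum_bound (hM : ∀ u x, |b u x| ≤ M) (F : Finset (Finset (Fin n))) :
    ∃ B, ∀ u z, |setSum b F u z| ≤ B := by
  refine ⟨∑ S ∈ F, ∏ _i ∈ S, M, fun u z => ?_⟩
  refine (Finset.abs_sum_le_sum_abs _ _).trans (Finset.sum_le_sum fun S _ => ?_)
  rw [Finset.abs_prod]
  exact Finset.prod_le_prod (fun i _ => abs_nonneg _) fun i _ => hM _ _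

variable [MeasurableSpace Ω] {γ : Measure Ω} [IsProbabilityMeasure γ]

theorem integral_prod_mul_eq_zero {S : Finset (Fin n)} {i₀ : Fin n} (hi₀ : i₀ ∈ S) {u : U}
    (hb0 : ∫ x, b u x ∂γ = 0) {m : Fin n → Ω → ℝ} {c : ℝ} (hm : ∀ x, m i₀ x = c) :
    ∫ z, (∏ i ∈ S, b u (z i)) * ∏ i, m i (z i) ∂(Measure.pi fun _ => γ) = 0 := by
  classical
  have h : ∀ z : Fin n → Ω, (∏ i ∈ S, b u (z i)) * ∏ i, m i (z i)
      = ∏ i, (if i ∈ S then b u (z i) else 1) * m i (z i) := by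
    intro z
    rw [Finset.prod_mul_distrib, Finset.prod_ite_mem, Finset.univ_inter]
  simp_rw [h]
  rw [integral_fintype_prod_eq_prod (f := fun i x => (if i ∈ S then b u x else 1) * m i x)]
  refine Finset.prod_eq_zero (Finset.mem_univ i₀) ?_
  simp [hi₀, hm, integral_mul_const, hb0]

/-- Products over distinct sets of samples are orthogonal, since some sample occurs in only one of
them. -/
theorem integral_prod_mul_prod (S T : Finset (Fin n)) (u v : U)
    (hb0 : ∀ u, ∫ x, b u x ∂γ = 0) :
    ∫ z, (∏ i ∈ S, b u (z i)) * ∏ i ∈ T, b v (z i) ∂(Measure.pi fun _ => γ)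
      = if S = T then (∫ x, b u x * b v x ∂γ) ^ S.card else 0 := by
  classical
  have h : ∀ z : Fin n → Ω, (∏ i ∈ S, b u (z i)) * ∏ i ∈ T, b v (z i)
      = ∏ i, (if i ∈ S then b u (z i) else 1) * (if i ∈ T then b v (z i) else 1) := by
    intro z
    rw [Finset.prod_mul_distrib, Finset.prod_ite_mem, Finset.prod_ite_mem, Finset.univ_inter,
      Finset.univ_inter]
  simp_rw [h]
  rw [integral_fintype_prod_eq_prod
    (f := fun i x => (if i ∈ S then b u x else 1) * (if i ∈ T then b v x else 1))]
  split_ifs with hST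
  · subst hST
    rw [← Finset.prod_const, ← Finset.univ_inter S, ← Finset.prod_ite_mem]
    refine Finset.prod_congr rfl fun i _ => ?_
    by_cases hi : i ∈ S <;> simp [hi]
  · obtain ⟨i, hi⟩ : ∃ i, ¬ (i ∈ S ↔ i ∈ T) := by
      by_contra! h
      exact hST (Finset.ext h)
    refine Finset.prod_eq_zero (Finset.mem_univ i) ?_
    by_cases hiS : i ∈ S
    · have hiT : i ∉ T := fun hT => hi ⟨fun _ => hT, fun _ => hiS⟩
      simp [hiS, hiT, hb0]
    · have hiT : i ∈ T := by
        by_contra hT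
        exact hi ⟨fun h => absurd h hiS, fun h => absurd h hT⟩
      simp [hiS, hiT, hb0]

variable [MeasurableSpace U] {μ : Measure U} [IsProbabilityMeasure μ]

theorem measurable_setSum (hb : Measurable (Function.uncurry b)) (F : Finset (Finset (Fin n))) :
    Measurable (fun p : U × (Fin n → Ω) => setSum b F p.1 p.2) := by
  unfold setSum
  refine Finset.measurable_sum _ fun S _ => Finset.measurable_prod _ fun i _ => ?_
  exact hb.comp (measurable_fst.prodMk ((measurable_pi_apply i).comp measurable_snd))

theorem integrable_bounded_mul {α β : Type*} [MeasurableSpace α] [MeasurableSpace β]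
    {μ : Measure α} {ν : Measure β} [IsProbabilityMeasure μ] [IsProbabilityMeasure ν]
    {H : α → β → ℝ} (hH : Measurable fun p : α × β => H p.1 p.2) {B : ℝ}
    (hB : ∀ a z, |H a z| ≤ B) {φ : β → ℝ} (hφ : Integrable φ ν) :
    Integrable (fun p : α × β => H p.1 p.2 * φ p.2) (μ.prod ν) :=
  (hφ.comp_snd μ).bdd_mul hH.aestronglyMeasurable
    (Filter.Eventually.of_forall fun p => hB p.1 p.2)

theorem integrable_setSum (hb : Measurable (Function.uncurry b)) (hM : ∀ u x, |b u x| ≤ M)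
    (F : Finset (Finset (Fin n))) (z : Fin n → Ω) :
    Integrable (fun u => setSum b F u z) μ := by
  obtain ⟨B, hB⟩ := exists_setSum_bound hM F
  exact Integrable.of_bound
    ((measurable_setSum hb F).comp (measurable_id.prodMk measurable_const)).aestronglyMeasurable B
    (Filter.Eventually.of_forall fun u => hB u z)

/-- The part of a mixture of product densities that carries the large sets of samples is
orthogonal to products of functions of few samples. -/
theorem integral_largeSets_mul_eq_zero (hb : Measurable (Function.uncurry b))
    (hM : ∀ u x, |b u x| ≤ M) (hb0 : ∀ u, ∫ x, b u x ∂γ = 0) {k : ℕ} {T : Finset (Fin n)}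
    (hT : T.card ≤ k) {m : Fin n → Ω → ℝ} (hm : ∀ i, Integrable (m i) γ)
    (hmT : ∀ i, i ∉ T → ∃ c, ∀ x, m i x = c) :
    ∫ z, (∫ u, setSum b (largeSets n k) u z ∂μ) * ∏ i, m i (z i) ∂(Measure.pi fun _ => γ) = 0 := by
  obtain ⟨B, hB⟩ := exists_setSum_bound hM (largeSets n k)
  have hmi : Integrable (fun z : Fin n → Ω => ∏ i, m i (z i)) (Measure.pi fun _ => γ) :=
    Integrable.fintype_prod hm
  simp_rw [← integral_mul_const]
  have hI := integrable_bounded_mul (μ := μ) (measurable_setSum hb (largeSets n k)) hB hmi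
  rw [← integral_integral_swap hI]
  refine integral_eq_zero_of_ae (Filter.Eventually.of_forall fun u => ?_)
  simp only [Pi.zero_apply, setSum, Finset.sum_mul]
  rw [integral_finsetSum]
  · refine Finset.sum_eq_zero fun S hS => ?_
    have hS' : ¬ S.card ≤ k := (Finset.mem_filter.1 hS).2
    -- A sample of `S` on which `∏ i, m i` does not depend; it integrates to `0`.
    obtain ⟨i, hi, hiT⟩ : ∃ i ∈ S, i ∉ T := by
      by_contra! h
      exact hS' ((Finset.card_le_card h).trans hT)
    obtain ⟨c, hc⟩ := hmT i hiT
    exact integral_prod_mul_eq_zero hi (hb0 u) hc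
  · intro S _
    refine hmi.bdd_mul (c := ∏ _i ∈ S, M) ?_ (Filter.Eventually.of_forall fun z => ?_)
    · refine Measurable.aestronglyMeasurable (Finset.measurable_prod _ fun i _ => ?_)
      exact hb.comp (measurable_const.prodMk (measurable_pi_apply i))
    · rw [Real.norm_eq_abs, Finset.abs_prod]
      exact Finset.prod_le_prod (fun i _ => abs_nonneg _) fun i _ => hM _ _

/-- Second moment of the mixture of the products over the sets in `F`. -/
theorem integral_sq_setSum (hb : Measurable (Function.uncurry b)) (hM : ∀ u x, |b u x| ≤ M)
    (hb0 : ∀ u, ∫ x, b u x ∂γ = 0) (F : Finset (Finset (Fin n))) :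
    ∫ z, (∫ u, setSum b F u z ∂μ) ^ 2 ∂(Measure.pi fun _ => γ)
      = ∫ v, ∫ u, ∑ S ∈ F, (∫ x, b u x * b v x ∂γ) ^ S.card ∂μ ∂μ := by
  obtain ⟨B, hB⟩ := exists_setSum_bound hM F
  have hmeas := measurable_setSum hb F
  have hin : ∀ u v, ∫ z, setSum b F u z * setSum b F v z ∂(Measure.pi fun _ => γ)
      = ∑ S ∈ F, (∫ x, b u x * b v x ∂γ) ^ S.card := by
    intro u v
    simp only [setSum, Finset.sum_mul_sum]
    have hi : ∀ S T : Finset (Fin n), Integrable (fun z : Fin n → Ω =>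
        (∏ i ∈ S, b u (z i)) * ∏ i ∈ T, b v (z i)) (Measure.pi fun _ => γ) := by
      intro S T
      have hm : ∀ (S : Finset (Fin n)) (u : U), Measurable fun z : Fin n → Ω =>
          ∏ i ∈ S, b u (z i) := fun S u => Finset.measurable_prod _ fun i _ =>
        hb.comp (measurable_const.prodMk (measurable_pi_apply i))
      have hbd : ∀ (S : Finset (Fin n)) (u : U) (z : Fin n → Ω),
          |∏ i ∈ S, b u (z i)| ≤ ∏ _i ∈ S, M := fun S u z => by
        rw [Finset.abs_prod]
        exact Finset.prod_le_prod (fun i _ => abs_nonneg _) fun i _ => hM _ _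
      refine Integrable.of_bound ((hm S u).mul (hm T v)).aestronglyMeasurable
        ((∏ _i ∈ S, M) * ∏ _i ∈ T, M) (Filter.Eventually.of_forall fun z => ?_)
      rw [Real.norm_eq_abs, abs_mul]
      exact mul_le_mul (hbd S u z) (hbd T v z) (abs_nonneg _) ((abs_nonneg _).trans (hbd S u z))
    rw [integral_finsetSum _ fun S _ => integrable_finsetSum _ fun T _ => hi S T]
    refine Finset.sum_congr rfl fun S hS => ?_
    rw [integral_finsetSum _ fun T _ => hi S T]
    simp_rw [integral_prod_mul_prod S _ u v hb0]
    rw [Finset.sum_ite_eq, if_pos hS]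
  have hm3 : Measurable fun q : (U × U) × (Fin n → Ω) =>
      setSum b F q.1.1 q.2 * setSum b F q.1.2 q.2 :=
    (hmeas.comp ((measurable_fst.comp measurable_fst).prodMk measurable_snd)).mul
      (hmeas.comp ((measurable_snd.comp measurable_fst).prodMk measurable_snd))
  have hi3 : Integrable (fun q : (U × U) × (Fin n → Ω) =>
      setSum b F q.1.1 q.2 * setSum b F q.1.2 q.2)
      ((μ.prod μ).prod (Measure.pi fun _ => γ)) := by
    refine Integrable.of_bound hm3.aestronglyMeasurable (B * B)
      (Filter.Eventually.of_forall fun q => ?_)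
    rw [Real.norm_eq_abs, abs_mul]
    exact mul_le_mul (hB _ _) (hB _ _) (abs_nonneg _) ((abs_nonneg _).trans (hB q.1.1 q.2))
  have h1 : ∀ z, (∫ u, setSum b F u z ∂μ) ^ 2
      = ∫ q : U × U, setSum b F q.1 z * setSum b F q.2 z ∂(μ.prod μ) := by
    intro z
    rw [sq, ← integral_prod_mul]
  simp_rw [h1]
  rw [← integral_integral_swap (f := fun (q : U × U) (z : Fin n → Ω) =>
    setSum b F q.1 z * setSum b F q.2 z) hi3]
  simp_rw [hin]
  have hi2 := hi3.integral_prod_left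
  simp only [hin] at hi2
  rw [integral_prod_symm _ hi2]

end Mixture

/-! ### The projection of the likelihood ratio -/

/-- The centred relative density of one planted sample. -/
noncomputable def centredDensity {d : ℕ} (ρ σ : ℝ) (u : UnitSphere d)
    (z : EuclideanSpace ℝ (Fin d)) : ℝ :=
  profile ρ σ (inner ℝ (u : EuclideanSpace ℝ (Fin d)) z) - 1

theorem measurable_centredDensity {d : ℕ} (ρ σ : ℝ) :
    Measurable (Function.uncurry (centredDensity (d := d) ρ σ)) := by
  have h := continuous_profile ρ σ
  refine Continuous.measurable (f := fun p : UnitSphere d × EuclideanSpace ℝ (Fin d) =>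
    profile ρ σ (inner ℝ (p.1 : EuclideanSpace ℝ (Fin d)) p.2) - 1) ?_
  fun_prop

theorem exists_centredDensity_bound {d : ℕ} (ρ : ℝ) {σ : ℝ} (hσ : 0 < σ) (hσ1 : σ < 1) :
    ∃ M, ∀ (u : UnitSphere d) z, |centredDensity ρ σ u z| ≤ M := by
  obtain ⟨B, hB⟩ := exists_profile_bound ρ hσ hσ1
  refine ⟨B + 1, fun u z => (abs_sub _ _).trans ?_⟩
  rw [abs_one]
  gcongr
  exact hB _

theorem integrable_profile_inner {d : ℕ} (ρ : ℝ) {σ : ℝ} (hσ : 0 < σ) (hσ1 : σ < 1)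
    (u : EuclideanSpace ℝ (Fin d)) :
    Integrable (fun z => profile ρ σ (inner ℝ u z))
      (stdGaussian (EuclideanSpace ℝ (Fin d))) := by
  obtain ⟨B, hB⟩ := exists_profile_bound ρ hσ hσ1
  have h := continuous_profile ρ σ
  exact Integrable.of_bound (Continuous.aestronglyMeasurable (by fun_prop)) B
    (Filter.Eventually.of_forall fun z => hB _)

theorem integral_centredDensity {d : ℕ} (ρ : ℝ) {σ : ℝ} (hσ : 0 < σ) (hσ1 : σ < 1)
    (u : UnitSphere d) :
    ∫ z, centredDensity ρ σ u z ∂(stdGaussian (EuclideanSpace ℝ (Fin d))) = 0 := by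
  unfold centredDensity
  rw [integral_sub (integrable_profile_inner ρ hσ hσ1 _) (integrable_const _),
    integral_stdGaussian_inner _ (by simp) (continuous_profile ρ σ), integral_profile ρ hσ hσ1]
  simp

theorem integral_centredDensity_mul {d : ℕ} (ρ : ℝ) {σ : ℝ} (hσ : 0 < σ) (hσ1 : σ < 1)
    (u v : UnitSphere d) :
    ∫ z, centredDensity ρ σ u z * centredDensity ρ σ v z
        ∂(stdGaussian (EuclideanSpace ℝ (Fin d)))
      = overlap ρ (1 - σ ^ 2) (inner ℝ (u : EuclideanSpace ℝ (Fin d)) v) - 1 := by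
  have hu := integrable_profile_inner ρ hσ hσ1 (u : EuclideanSpace ℝ (Fin d))
  have hv := integrable_profile_inner ρ hσ hσ1 (v : EuclideanSpace ℝ (Fin d))
  have huv : Integrable (fun z => profile ρ σ (inner ℝ (u : EuclideanSpace ℝ (Fin d)) z) *
      profile ρ σ (inner ℝ (v : EuclideanSpace ℝ (Fin d)) z))
      (stdGaussian (EuclideanSpace ℝ (Fin d))) := by
    obtain ⟨B, hB⟩ := exists_profile_bound ρ hσ hσ1
    exact hv.bdd_mul hu.aestronglyMeasurable (Filter.Eventually.of_forall fun z => hB _)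
  have h : ∀ z : EuclideanSpace ℝ (Fin d), centredDensity ρ σ u z * centredDensity ρ σ v z
      = profile ρ σ (inner ℝ (u : EuclideanSpace ℝ (Fin d)) z) *
        profile ρ σ (inner ℝ (v : EuclideanSpace ℝ (Fin d)) z)
        - profile ρ σ (inner ℝ (u : EuclideanSpace ℝ (Fin d)) z) - centredDensity ρ σ v z := by
    intro z
    unfold centredDensity
    ring
  have hc : Integrable (fun z => centredDensity ρ σ v z)
      (stdGaussian (EuclideanSpace ℝ (Fin d))) := hv.sub (integrable_const 1)
  simp_rw [h]
  have h2 : Integrable (fun z => profile ρ σ (inner ℝ (u : EuclideanSpace ℝ (Fin d)) z) *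
      profile ρ σ (inner ℝ (v : EuclideanSpace ℝ (Fin d)) z)
      - profile ρ σ (inner ℝ (u : EuclideanSpace ℝ (Fin d)) z))
      (stdGaussian (EuclideanSpace ℝ (Fin d))) := huv.sub hu
  rw [integral_sub h2 hc, integral_sub huv hu, integral_centredDensity ρ hσ hσ1,
    integral_profile_mul ρ hσ hσ1 _ _ (by simp) (by simp),
    integral_stdGaussian_inner _ (by simp) (continuous_profile ρ σ), integral_profile ρ hσ hσ1,
    sub_zero]

/-- The nonempty sets of at most `k` samples. -/
def nonemptySmallSets (n k : ℕ) : Finset (Finset (Fin n)) :=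
  Finset.univ.filter fun S => 1 ≤ S.card ∧ S.card ≤ k

theorem setSum_smallSets {U Ω : Type*} {n : ℕ} (b : U → Ω → ℝ) (k : ℕ) (u : U) (z : Fin n → Ω) :
    setSum b (smallSets n k) u z = 1 + setSum b (nonemptySmallSets n k) u z := by
  have h : smallSets n k = insert ∅ (nonemptySmallSets n k) := by
    ext S
    rcases S.eq_empty_or_nonempty with rfl | hS
    · simp [smallSets]
    · simp [smallSets, nonemptySmallSets, hS.ne_empty, hS]
  rw [h, setSum, Finset.sum_insert (by simp [nonemptySmallSets]), Finset.prod_empty, setSum]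

theorem sum_nonemptySmallSets (n k : ℕ) (x : ℝ) :
    ∑ S ∈ nonemptySmallSets n k, x ^ S.card = ∑ j ∈ Finset.Icc 1 k, (n.choose j : ℝ) * x ^ j := by
  rw [← Finset.sum_fiberwise_of_maps_to (t := Finset.Icc 1 k) (g := Finset.card)]
  · refine Finset.sum_congr rfl fun j hj => ?_
    rw [Finset.mem_Icc] at hj
    have h : (nonemptySmallSets n k).filter (fun S => S.card = j)
        = Finset.powersetCard j Finset.univ := by
      ext S
      simp only [nonemptySmallSets, Finset.mem_filter, Finset.mem_univ, true_and,
        Finset.mem_powersetCard, Finset.subset_univ]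
      exact ⟨fun h => h.2, fun h => ⟨h ▸ hj, h⟩⟩
    rw [h, Finset.sum_congr rfl (g := fun _ => x ^ j) fun S hS => by
      rw [(Finset.mem_powersetCard.1 hS).2], Finset.sum_const, Finset.card_powersetCard,
      Finset.card_univ, Fintype.card_fin, nsmul_eq_mul]
  · intro S hS
    exact Finset.mem_Icc.2 (Finset.mem_filter.1 hS).2

/-- The mean over the hidden direction of the products of the centred densities over the sets of
samples in `F`. -/
noncomputable def meanSetSum {n : ℕ} (d : ℕ) (ρ σ : ℝ) (F : Finset (Finset (Fin n)))
    (z : Fin n → EuclideanSpace ℝ (Fin d)) : ℝ :=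
  ∫ u, setSum (centredDensity ρ σ) F u z ∂(uniformSphere d)

section

variable {d : ℕ} [NeZero d] {n : ℕ} {ρ σ : ℝ}

theorem exists_meanSetSum_bound (ρ : ℝ) (hσ : 0 < σ) (hσ1 : σ < 1)
    (F : Finset (Finset (Fin n))) : ∃ B, ∀ z, ‖meanSetSum d ρ σ F z‖ ≤ B := by
  obtain ⟨M, hM⟩ := exists_centredDensity_bound (d := d) ρ hσ hσ1
  obtain ⟨B, hB⟩ := exists_setSum_bound hM F
  refine ⟨B, fun z => ?_⟩
  have := norm_integral_le_of_norm_le_const (μ := uniformSphere d)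
    (f := fun u => setSum (centredDensity ρ σ) F u z) (C := B)
    (Filter.Eventually.of_forall fun u => hB u z)
  simpa [meanSetSum] using this

theorem aestronglyMeasurable_meanSetSum (ρ σ : ℝ) (F : Finset (Finset (Fin n))) :
    AEStronglyMeasurable (meanSetSum d ρ σ F) (nullLaw n d) :=
  ((measurable_setSum (measurable_centredDensity ρ σ) F).stronglyMeasurable.integral_prod_left'
    (μ := uniformSphere d)).aestronglyMeasurable

theorem memLp_meanSetSum (ρ : ℝ) (hσ : 0 < σ) (hσ1 : σ < 1) (F : Finset (Finset (Fin n))) :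
    MemLp (meanSetSum d ρ σ F) 2 (nullLaw n d) := by
  obtain ⟨B, hB⟩ := exists_meanSetSum_bound (d := d) ρ hσ hσ1 F
  exact MemLp.of_bound (aestronglyMeasurable_meanSetSum ρ σ F) B (Filter.Eventually.of_forall hB)

theorem likelihoodRatio_eq (h0 : 0 ≤ ρ) (h1 : ρ ≤ 1) (hσ : 0 < σ) (hσ1 : σ < 1) (k : ℕ)
    (z : Fin n → EuclideanSpace ℝ (Fin d)) :
    likelihoodRatio n d ρ σ z = 1 + meanSetSum d ρ σ (nonemptySmallSets n k) z
      + meanSetSum d ρ σ (largeSets n k) z := by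
  obtain ⟨M, hM⟩ := exists_centredDensity_bound (d := d) ρ hσ hσ1
  have hi : ∀ F : Finset (Finset (Fin n)), Integrable
      (fun u => setSum (centredDensity ρ σ) F u z) (uniformSphere d) := fun F =>
    integrable_setSum (measurable_centredDensity ρ σ) hM F z
  have h : ∀ u : UnitSphere d, ∏ i, relDensity ρ σ (u : EuclideanSpace ℝ (Fin d)) (z i)
      = 1 + setSum (centredDensity ρ σ) (nonemptySmallSets n k) u z
        + setSum (centredDensity ρ σ) (largeSets n k) u z := by
    intro u
    rw [← setSum_smallSets, ← prod_one_add_eq_setSum]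
    refine Finset.prod_congr rfl fun i _ => ?_
    rw [relDensity_eq_profile h0 h1 hσ _ _ (by simp), centredDensity]
    ring
  rw [likelihoodRatio]
  simp_rw [h]
  have h2 : Integrable (fun u => 1 + setSum (centredDensity ρ σ) (nonemptySmallSets n k) u z)
      (uniformSphere d) := (integrable_const _).add (hi _)
  rw [integral_add h2 (hi _), integral_add (integrable_const _) (hi _)]
  simp [meanSetSum]

theorem integrable_coord_monomial (m : Fin d → ℕ) :
    Integrable (fun x : EuclideanSpace ℝ (Fin d) => ∏ j, x j ^ m j)
      (stdGaussian (EuclideanSpace ℝ (Fin d))) := by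
  have h : Integrable (fun x : EuclideanSpace ℝ (Fin d) => ‖x‖ ^ (∑ j, m j))
      (stdGaussian (EuclideanSpace ℝ (Fin d))) := by
    have := (IsGaussian.memLp_id (stdGaussian (EuclideanSpace ℝ (Fin d)))
      ((∑ j, m j : ℕ) : ENNReal) (by simp)).integrable_norm_pow'
    simpa using this
  refine h.mono' (Continuous.aestronglyMeasurable (by fun_prop))
    (Filter.Eventually.of_forall fun x => ?_)
  rw [Real.norm_eq_abs, Finset.abs_prod, ← Finset.prod_pow_eq_pow_sum]
  refine Finset.prod_le_prod (fun j _ => abs_nonneg _) fun j _ => ?_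
  rw [abs_pow]
  exact pow_le_pow_left₀ (abs_nonneg _) (PiLp.norm_apply_le x j) _

/-- The terms of the likelihood ratio with more than `k` samples are orthogonal to the polynomials
of samplewise degree at most `(∞, k)`. -/
theorem integral_meanSetSum_largeSets_mul_eval (ρ : ℝ) (hσ : 0 < σ) (hσ1 : σ < 1) {k : ℕ}
    {p : MvPolynomial (Fin n × Fin d) ℝ} (hp : p ∈ samplewiseDegreeLE n d ⊤ k) :
    ∫ z, meanSetSum d ρ σ (largeSets n k) z * MvPolynomial.eval (fun ij => z ij.1 ij.2) p
      ∂(nullLaw n d) = 0 := by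
  obtain ⟨M, hM⟩ := exists_centredDensity_bound (d := d) ρ hσ hσ1
  obtain ⟨B, hB⟩ := exists_meanSetSum_bound (d := d) ρ hσ hσ1 (largeSets n k)
  have hmon : ∀ m : (Fin n × Fin d) →₀ ℕ, Integrable
      (fun z : Fin n → EuclideanSpace ℝ (Fin d) => ∏ i, ∏ j, z i j ^ m (i, j)) (nullLaw n d) :=
    fun m => Integrable.fintype_prod
      (f := fun i (x : EuclideanSpace ℝ (Fin d)) => ∏ j, x j ^ m (i, j))
      fun i => integrable_coord_monomial fun j => m (i, j)
  simp_rw [MvPolynomial.eval_eq', Fintype.prod_prod_type, Finset.mul_sum, mul_left_comm]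
  rw [integral_finsetSum]
  · refine Finset.sum_eq_zero fun m hm => ?_
    rw [integral_const_mul]
    have hmem := (MvPolynomial.mem_restrictSupport_iff ℝ).1 hp hm
    have h := integral_largeSets_mul_eq_zero (μ := uniformSphere d)
      (measurable_centredDensity ρ σ) hM (integral_centredDensity ρ hσ hσ1) hmem.2
      (m := fun i (x : EuclideanSpace ℝ (Fin d)) => ∏ j, x j ^ m (i, j))
      (fun i => integrable_coord_monomial fun j => m (i, j)) (by
        intro i hi
        refine ⟨1, fun x => Finset.prod_eq_one fun j _ => ?_⟩
        simp only [Finset.mem_filter, Finset.mem_univ, true_and, not_not] at hi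
        rw [Finset.sum_eq_zero_iff.1 hi j (Finset.mem_univ _), pow_zero])
    exact mul_eq_zero_of_right _ h
  · intro m _
    exact ((hmon m).bdd_mul (aestronglyMeasurable_meanSetSum ρ σ _)
      (Filter.Eventually.of_forall hB)).const_mul _

theorem const_one_mem_samplewiseSpan (n d : ℕ) (k : ℕ) :
    Lp.const 2 (nullLaw n d) (1 : ℝ) ∈ samplewiseSpan n d ⊤ k := by
  refine ⟨MvPolynomial.C 1, ?_, ?_⟩
  · rw [samplewiseDegreeLE, ← MvPolynomial.monomial_zero',
      MvPolynomial.monomial_mem_restrictSupport]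
    simp
  · filter_upwards [Lp.coeFn_const 2 (nullLaw n d) (1 : ℝ)] with z hz
    rw [hz, MvPolynomial.eval_C, Function.const_apply]

/-- The squared norm of the centred low-degree likelihood ratio is at most the truncated binomial
expansion of the correlation of two independent hidden directions. -/
theorem exists_norm_lowDegreeLR_sq_le (h0 : 0 ≤ ρ) (h1 : ρ ≤ 1) (hσ : 0 < σ) (hσ1 : σ < 1)
    (k : ℕ) :
    ∃ h : MemLp (likelihoodRatio n d ρ σ) 2 (nullLaw n d),
      ‖lowDegreeLR n d ⊤ k ρ σ h‖ ^ 2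
        ≤ ∫ v : UnitSphere d, ∫ u : UnitSphere d, ∑ j ∈ Finset.Icc 1 k, (n.choose j : ℝ) *
          (overlap ρ (1 - σ ^ 2) (inner ℝ (u : EuclideanSpace ℝ (Fin d)) v) - 1) ^ j
            ∂(uniformSphere d) ∂(uniformSphere d) := by
  obtain ⟨M, hM⟩ := exists_centredDensity_bound (d := d) ρ hσ hσ1
  have hS := memLp_meanSetSum (d := d) ρ hσ hσ1 (nonemptySmallSets n k)
  have hL := memLp_meanSetSum (d := d) ρ hσ hσ1 (largeSets n k)
  have hc : MemLp (fun _ : Fin n → EuclideanSpace ℝ (Fin d) => (1 : ℝ)) 2 (nullLaw n d) :=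
    memLp_const 1
  have heq : likelihoodRatio n d ρ σ = (fun _ => 1) + meanSetSum d ρ σ (nonemptySmallSets n k)
      + meanSetSum d ρ σ (largeSets n k) := by
    ext z
    exact likelihoodRatio_eq h0 h1 hσ hσ1 k z
  have h : MemLp (likelihoodRatio n d ρ σ) 2 (nullLaw n d) := by
    rw [heq]
    exact (hc.add hS).add hL
  refine ⟨h, ?_⟩
  have hLp : h.toLp _ = Lp.const 2 (nullLaw n d) 1 + hS.toLp _ + hL.toLp _ := by
    have : h.toLp _ = ((hc.add hS).add hL).toLp _ := by
      rw [MemLp.toLp_eq_toLp_iff, heq]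
    rw [this, MemLp.toLp_add (hc.add hS) hL, MemLp.toLp_add hc hS]
    rfl
  have horth : hL.toLp _ ∈ (samplewiseSpan n d ⊤ k).topologicalClosureᗮ := by
    rw [Submodule.orthogonal_closure, Submodule.mem_orthogonal]
    rintro g ⟨p, hp, hgp⟩
    rw [L2.inner_def, ← integral_meanSetSum_largeSets_mul_eval ρ hσ hσ1 hp]
    refine integral_congr_ae ?_
    filter_upwards [hgp, hL.coeFn_toLp] with z hz1 hz2
    rw [hz1, hz2]
    simp
  have hone : (samplewiseSpan n d ⊤ k).topologicalClosure.starProjection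
      (Lp.const 2 (nullLaw n d) 1) = Lp.const 2 (nullLaw n d) 1 :=
    Submodule.starProjection_eq_self_iff.2
      (Submodule.le_topologicalClosure _ (const_one_mem_samplewiseSpan n d k))
  -- The projection fixes `1`, kills the large sets, and does not increase the norm of the rest.
  have hLR : lowDegreeLR n d ⊤ k ρ σ h
      = (samplewiseSpan n d ⊤ k).topologicalClosure.starProjection (hS.toLp _) := by
    rw [lowDegreeLR, lowDegreeProj, hLp, map_add, map_add, hone,
      (Submodule.starProjection_apply_eq_zero_iff _).2 horth]
    abel
  have hnorm : ‖lowDegreeLR n d ⊤ k ρ σ h‖ ^ 2 ≤ ‖hS.toLp _‖ ^ 2 := by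
    rw [hLR]
    exact pow_le_pow_left₀ (norm_nonneg _) (Submodule.norm_starProjection_apply_le _ _) 2
  refine hnorm.trans (le_of_eq ?_)
  rw [← real_inner_self_eq_norm_sq, L2.inner_def]
  have h2 : ∫ z, inner ℝ (hS.toLp _ z) (hS.toLp _ z) ∂(nullLaw n d)
      = ∫ z, meanSetSum d ρ σ (nonemptySmallSets n k) z ^ 2 ∂(nullLaw n d) := by
    refine integral_congr_ae ?_
    filter_upwards [hS.coeFn_toLp] with z hz
    rw [hz, real_inner_self_eq_norm_sq, Real.norm_eq_abs, sq_abs]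
  rw [h2]
  have h3 := integral_sq_setSum (μ := uniformSphere d) (measurable_centredDensity ρ σ) hM
    (integral_centredDensity ρ hσ hσ1) (nonemptySmallSets n k)
  simp_rw [integral_centredDensity_mul ρ hσ hσ1, sum_nonemptySmallSets] at h3
  exact h3

end

/-! ### The overlap away from zero -/

/-- The sum over pairs of atoms: two nonzero atoms contribute a multiple of `cosh`, and writing it
as `1 + (cosh - 1)` completes the square. -/
theorem overlap_eq {ρ : ℝ} (hρ : 0 < ρ) (r t : ℝ) :
    overlap ρ r t = (√(1 - r ^ 2 * t ^ 2))⁻¹ *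
      ((1 - ρ + ρ * Real.exp (-(r * t ^ 2 / (ρ * (1 - r ^ 2 * t ^ 2))) / 2)) ^ 2
      + ρ ^ 2 * Real.exp (-(r * t ^ 2 / (ρ * (1 - r ^ 2 * t ^ 2)))) *
        (Real.cosh (t / ρ / (1 - r ^ 2 * t ^ 2)) - 1)) := by
  obtain ⟨D, hD⟩ : ∃ D, D = 1 - r ^ 2 * t ^ 2 := ⟨_, rfl⟩
  have hs : (√ρ)⁻¹ ^ 2 = ρ⁻¹ := by rw [inv_pow, Real.sq_sqrt hρ.le]
  obtain ⟨s, hs'⟩ : ∃ s, s = (√ρ)⁻¹ := ⟨_, rfl⟩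
  have e1 : (2 * t * s * s - r * t ^ 2 * (s ^ 2 + s ^ 2)) / (2 * D)
      = t / ρ / D + -(r * t ^ 2 / (ρ * D)) := by
    rw [show (2 * t * s * s - r * t ^ 2 * (s ^ 2 + s ^ 2)) = 2 * (t - r * t ^ 2) * s ^ 2 by ring,
      hs', hs]
    simp only [div_eq_mul_inv, mul_inv]
    ring
  have e2 : (2 * t * s * -s - r * t ^ 2 * (s ^ 2 + (-s) ^ 2)) / (2 * D)
      = -(t / ρ / D) + -(r * t ^ 2 / (ρ * D)) := by
    rw [show (2 * t * s * -s - r * t ^ 2 * (s ^ 2 + (-s) ^ 2)) = 2 * (-t - r * t ^ 2) * s ^ 2 by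
      ring, hs', hs]
    simp only [div_eq_mul_inv, mul_inv]
    ring
  have e3 : -(r * t ^ 2 * s ^ 2) / (2 * D) = -(r * t ^ 2 / (ρ * D)) / 2 := by
    rw [hs', hs]
    simp only [div_eq_mul_inv, mul_inv]
    ring
  have e4 : (2 * t * -s * s - r * t ^ 2 * ((-s) ^ 2 + s ^ 2)) / (2 * D)
      = (2 * t * s * -s - r * t ^ 2 * (s ^ 2 + (-s) ^ 2)) / (2 * D) := by ring
  have e5 : (2 * t * -s * -s - r * t ^ 2 * ((-s) ^ 2 + (-s) ^ 2)) / (2 * D)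
      = (2 * t * s * s - r * t ^ 2 * (s ^ 2 + s ^ 2)) / (2 * D) := by ring
  have e6 : (2 * t * s * 0 - r * t ^ 2 * (s ^ 2 + 0 ^ 2)) / (2 * D)
      = -(r * t ^ 2 * s ^ 2) / (2 * D) := by ring
  have e7 : (2 * t * -s * 0 - r * t ^ 2 * ((-s) ^ 2 + 0 ^ 2)) / (2 * D)
      = -(r * t ^ 2 * s ^ 2) / (2 * D) := by ring
  have e8 : (2 * t * 0 * s - r * t ^ 2 * (0 ^ 2 + s ^ 2)) / (2 * D)
      = -(r * t ^ 2 * s ^ 2) / (2 * D) := by ring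
  have e9 : (2 * t * 0 * -s - r * t ^ 2 * (0 ^ 2 + (-s) ^ 2)) / (2 * D)
      = -(r * t ^ 2 * s ^ 2) / (2 * D) := by ring
  have e10 : (2 * t * 0 * 0 - r * t ^ 2 * (0 ^ 2 + 0 ^ 2)) / (2 * D) = 0 := by ring
  simp only [overlap, mehler, Fin.sum_univ_three, atomMass, atomSite, Matrix.cons_val, one_div,
    ← hs', ← hD, e4, e5, e6, e7, e8, e9, e10, e1, e2, e3, Real.exp_add, Real.exp_zero,
    Real.cosh_eq]
  have e11 : Real.exp (-(r * t ^ 2 / (ρ * D)))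
      = Real.exp (-(r * t ^ 2 / (ρ * D)) / 2) ^ 2 := by
    rw [← Real.exp_nat_mul]
    congr 1
    push_cast
    ring
  rw [e11]
  ring

theorem one_le_inv_sqrt {x : ℝ} (h0 : 0 < x) (h1 : x ≤ 1) : 1 ≤ (√x)⁻¹ :=
  (one_le_inv₀ (Real.sqrt_pos.2 h0)).2 (Real.sqrt_le_one.2 h1)

/-- The exponent of Mehler's kernel at two nonzero atoms stays bounded as `r t` tends to `1`: the
two terms, each of order `1 / D`, cancel up to `w / (1 + r t)`. -/
theorem exponent_le {r w t D : ℝ} (hD : D = 1 - r ^ 2 * t ^ 2) (hrt : |r * t| < 1)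
    (hw : 0 ≤ w * t) (hr : 0 ≤ r) : w / D - r * t * w / D ≤ |w| := by
  have h := abs_lt.1 hrt
  have hDe : D = (1 - r * t) * (1 + r * t) := by rw [hD]; ring
  have h1 : w / D - r * t * w / D = w / (1 + r * t) := by
    rw [hDe]
    have := (by linarith [h.2] : (0 : ℝ) < 1 - r * t).ne'
    have := (by linarith [h.1] : (0 : ℝ) < 1 + r * t).ne'
    field_simp
  rw [h1, div_le_iff₀ (by linarith)]
  rcases le_total 0 w with h2 | h2
  · rw [abs_of_nonneg h2]
    nlinarith
  · rw [abs_of_nonpos h2]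
    nlinarith

/-- A bound for the overlap that is useful away from `t = 0`. -/
theorem abs_overlap_sub_one_le {ρ r t : ℝ} (hρ : 0 < ρ) (hρ1 : ρ ≤ 1) (hr0 : 0 ≤ r) (hr1 : r < 1)
    (ht : |t| ≤ 1) :
    |overlap ρ r t - 1| ≤ (√(1 - r ^ 2 * t ^ 2))⁻¹ * Real.exp (|t| / ρ) := by
  have hrt : |r * t| < 1 := by
    rw [abs_mul, abs_of_nonneg hr0]
    calc r * |t| ≤ r * 1 := by gcongr
      _ < 1 := by linarith
  have hD0 : 0 < 1 - r ^ 2 * t ^ 2 := by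
    have := (sq_lt_one_iff_abs_lt_one _).2 hrt
    rw [mul_pow] at this
    linarith
  have hD1 : 1 - r ^ 2 * t ^ 2 ≤ 1 := by
    have : 0 ≤ r ^ 2 * t ^ 2 := by positivity
    linarith
  have hJ := one_le_inv_sqrt hD0 hD1
  rw [overlap_eq hρ]
  obtain ⟨D, hD⟩ : ∃ D, D = 1 - r ^ 2 * t ^ 2 := ⟨_, rfl⟩
  rw [← hD] at hD0 hJ ⊢
  obtain ⟨J, hJe⟩ : ∃ J, J = (√D)⁻¹ := ⟨_, rfl⟩
  rw [← hJe] at hJ ⊢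
  obtain ⟨E, hE⟩ : ∃ E, E = Real.exp (|t| / ρ) := ⟨_, rfl⟩
  obtain ⟨a, ha⟩ : ∃ a, a = Real.exp (-(r * t ^ 2 / (ρ * D)) / 2) := ⟨_, rfl⟩
  have ha1 : a ≤ 1 := by
    rw [ha]
    refine Real.exp_le_one_iff.2 ?_
    have : 0 ≤ r * t ^ 2 / (ρ * D) := by positivity
    linarith
  have ha0 : 0 < a := ha ▸ Real.exp_pos _
  have hE1 : 1 ≤ E := by
    rw [hE]
    exact Real.one_le_exp (by positivity)
  have hw : |t / ρ| = |t| / ρ := by rw [abs_div, abs_of_pos hρ]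
  have hq : r * t ^ 2 / (ρ * D) = r * t * (t / ρ) / D := by
    field_simp
  have hcosh : Real.exp (-(r * t ^ 2 / (ρ * D))) * Real.cosh (t / ρ / D) ≤ E := by
    have h1 : Real.exp (-(r * t ^ 2 / (ρ * D))) * Real.exp (t / ρ / D) ≤ E := by
      rw [← Real.exp_add, hE, ← hw, hq]
      refine Real.exp_le_exp.2 ?_
      have := exponent_le (w := t / ρ) hD hrt
        (by rw [div_mul_eq_mul_div]; exact div_nonneg (mul_self_nonneg _) hρ.le) hr0
      linarith
    have h2 : Real.exp (-(r * t ^ 2 / (ρ * D))) * Real.exp (-(t / ρ / D)) ≤ E := by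
      rw [← Real.exp_add, hE, ← hw, hq]
      refine Real.exp_le_exp.2 ?_
      have := exponent_le (w := -(t / ρ)) (t := -t) (D := D) (r := r) (by rw [hD]; ring)
        (by rwa [mul_neg, abs_neg])
        (by rw [neg_mul_neg, div_mul_eq_mul_div]
            exact div_nonneg (mul_self_nonneg _) hρ.le) hr0
      rw [abs_neg, neg_div] at this
      calc _ = -(t / ρ / D) - r * -t * -(t / ρ) / D := by ring
        _ ≤ _ := this
    rw [Real.cosh_eq]
    linarith
  have ha2 : Real.exp (-(r * t ^ 2 / (ρ * D))) = a ^ 2 := by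
    rw [ha, ← Real.exp_nat_mul]
    congr 1
    push_cast
    ring
  rw [ha2] at hcosh ⊢
  rw [← ha, ← hE]
  have hch := Real.one_le_cosh (t / ρ / D)
  obtain ⟨c, hc⟩ : ∃ c, c = Real.cosh (t / ρ / D) := ⟨_, rfl⟩
  rw [← hc] at hcosh hch ⊢
  have hB0 : 0 ≤ (1 - ρ + ρ * a) ^ 2 + ρ ^ 2 * a ^ 2 * (c - 1) := by
    have : 0 ≤ c - 1 := by linarith
    positivity
  have hBE : (1 - ρ + ρ * a) ^ 2 + ρ ^ 2 * a ^ 2 * (c - 1) ≤ E := by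
    have h1 : (1 - ρ + ρ * a) ^ 2 + ρ ^ 2 * a ^ 2 * (c - 1)
        = (1 - ρ) ^ 2 + 2 * ρ * (1 - ρ) * a + ρ ^ 2 * (a ^ 2 * c) := by ring
    have h2 : 2 * ρ * (1 - ρ) * a ≤ 2 * ρ * (1 - ρ) * 1 := by
      have : 0 ≤ 1 - ρ := by linarith
      gcongr
    have h3 : ρ ^ 2 * (a ^ 2 * c) ≤ ρ ^ 2 * E := by gcongr
    have h4 : ρ ^ 2 ≤ 1 := pow_le_one₀ hρ.le hρ1
    rw [h1]
    nlinarith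
  rw [abs_le]
  constructor
  · have h1 : 0 ≤ J * ((1 - ρ + ρ * a) ^ 2 + ρ ^ 2 * a ^ 2 * (c - 1)) :=
      mul_nonneg (by linarith) hB0
    have h2 : 1 * 1 ≤ J * E := mul_le_mul hJ hE1 zero_le_one (by linarith)
    linarith
  · have : J * ((1 - ρ + ρ * a) ^ 2 + ρ ^ 2 * a ^ 2 * (c - 1)) ≤ J * E :=
      mul_le_mul_of_nonneg_left hBE (by linarith)
    linarith

/-! ### The overlap near zero -/

theorem exp_neg_le_quadratic {y : ℝ} (hy : 0 ≤ y) : Real.exp (-y) ≤ 1 - y + y ^ 2 / 2 := by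
  have h1 := Real.quadratic_le_exp_of_nonneg hy
  rw [Real.exp_neg, inv_le_iff_one_le_mul₀ (Real.exp_pos _)]
  have h2 : 0 ≤ 1 - y + y ^ 2 / 2 := by nlinarith [sq_nonneg (y - 1)]
  calc 1 ≤ (1 - y + y ^ 2 / 2) * (1 + y + y ^ 2 / 2) := by nlinarith [sq_nonneg (y ^ 2)]
    _ ≤ _ := mul_le_mul_of_nonneg_left h1 h2

theorem half_sq_le_cosh_sub_one (x : ℝ) : x ^ 2 / 2 ≤ Real.cosh x - 1 := by
  have h1 : Real.cosh x = 1 + 2 * Real.sinh (x / 2) ^ 2 := by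
    conv_lhs => rw [show x = 2 * (x / 2) by ring, Real.cosh_two_mul]
    rw [Real.cosh_sq]
    ring
  have h2 : (x / 2) ^ 2 ≤ Real.sinh (x / 2) ^ 2 := by
    rw [← sq_abs (x / 2), ← sq_abs (Real.sinh _), Real.abs_sinh]
    exact pow_le_pow_left₀ (abs_nonneg _) (Real.self_le_sinh_iff.2 (abs_nonneg _)) 2
  rw [h1]
  linarith

theorem cosh_sub_one_le {x : ℝ} (hx : x ^ 2 ≤ 2) :
    Real.cosh x - 1 ≤ x ^ 2 / 2 + (x ^ 2) ^ 2 / 4 := by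
  have h1 := Real.cosh_le_exp_half_sq x
  have h2 := Real.abs_exp_sub_one_sub_id_le (x := x ^ 2 / 2)
    (by rw [abs_of_nonneg (by positivity)]; linarith)
  have h3 := (abs_le.1 h2).2
  nlinarith

theorem inv_sqrt_one_sub_bounds {β : ℝ} (h0 : 0 ≤ β) (h1 : β ≤ 1 / 4) :
    1 + β / 2 ≤ (√(1 - β))⁻¹ ∧ (√(1 - β))⁻¹ ≤ 1 + β / 2 + β ^ 2 := by
  have hp : 0 < 1 - β := by linarith
  have hs : 0 < √(1 - β) := Real.sqrt_pos.2 hp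
  have hsq : √(1 - β) ^ 2 = 1 - β := Real.sq_sqrt hp.le
  constructor
  · rw [le_inv_comm₀ (by positivity) hs]
    refine Real.sqrt_le_iff.2 ⟨by positivity, ?_⟩
    rw [inv_pow, le_inv_comm₀ hp (by positivity), le_inv_comm₀ (by positivity) hp]
    rw [← one_div, le_div_iff₀ (by positivity)]
    nlinarith [pow_nonneg h0 3, pow_nonneg h0 2]
  · rw [inv_le_comm₀ hs (by positivity)]
    refine Real.le_sqrt_of_sq_le ?_
    rw [inv_pow, inv_le_iff_one_le_mul₀ (by positivity)]
    have h2 := pow_nonneg h0 2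
    have h3 := pow_nonneg h0 3
    have h4 := pow_nonneg h0 4
    have h5 : β ^ 5 ≤ β ^ 4 / 4 := by
      rw [pow_succ]
      nlinarith
    have h6 : β ^ 3 ≤ β ^ 2 / 4 := by
      rw [pow_succ]
      nlinarith
    nlinarith

/-- The factor `(1 - ρ + ρ exp (-q / 2))²` of the overlap, to first order in `T = t²`; here
`q = r T / (ρ (1 - β))`, and `β` stands for `r² T`. -/
theorem null_part_bounds {ρ r T β : ℝ} (hρ : 0 < ρ) (hρ1 : ρ ≤ 1) (hr0 : 0 ≤ r) (hr1 : r ≤ 1)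
    (hT : 0 ≤ T) (hβ0 : 0 ≤ β) (hβ : β ≤ T) (hβ4 : β ≤ 1 / 4) :
    1 - r * T - 2 * (T ^ 2 / ρ ^ 2)
        ≤ (1 - ρ + ρ * Real.exp (-(r * T / (ρ * (1 - β))) / 2)) ^ 2 ∧
      (1 - ρ + ρ * Real.exp (-(r * T / (ρ * (1 - β))) / 2)) ^ 2
        ≤ 1 - r * T + T ^ 2 / ρ ^ 2 := by
  have hD : 0 < 1 - β := by linarith
  obtain ⟨q, hq⟩ : ∃ q, q = r * T / (ρ * (1 - β)) := ⟨_, rfl⟩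
  have hq0 : 0 ≤ q := by rw [hq]; positivity
  have hrT : 0 ≤ r * T := mul_nonneg hr0 hT
  have hrT1 : r * T ≤ T := mul_le_of_le_one_left hT hr1
  have hρq : ρ * q = r * T / (1 - β) := by
    rw [hq]
    field_simp
  have hρq1 : r * T ≤ ρ * q := by
    rw [hρq, le_div_iff₀ hD]
    nlinarith
  have hρq2 : ρ * q ≤ r * T + 4 / 3 * T ^ 2 := by
    rw [hρq, div_le_iff₀ hD]
    nlinarith [mul_nonneg hrT hβ0, mul_nonneg hT hβ0]
  have hρq3 : ρ * q ≤ 4 / 3 * T := by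
    rw [hρq, div_le_iff₀ hD]
    nlinarith
  have hT2 : T ^ 2 ≤ T ^ 2 / ρ ^ 2 :=
    le_div_self (sq_nonneg _) (by positivity) (pow_le_one₀ hρ.le hρ1)
  have hε : ρ * q ^ 2 ≤ 16 / 9 * (T ^ 2 / ρ ^ 2) := by
    have h1 : (ρ * q) ^ 2 ≤ (4 / 3 * T) ^ 2 := pow_le_pow_left₀ (by positivity) hρq3 2
    rw [← mul_div_assoc, le_div_iff₀ (by positivity)]
    have h2 : ρ * q ^ 2 * ρ ^ 2 = (ρ * q) ^ 2 * ρ := by ring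
    rw [h2]
    nlinarith [sq_nonneg (ρ * q)]
  rw [← hq, show -q / 2 = -(q / 2) by ring]
  have hl := Real.add_one_le_exp (-(q / 2))
  have hu := exp_neg_le_quadratic (y := q / 2) (by positivity)
  obtain ⟨y, hy⟩ : ∃ y, y = 1 - Real.exp (-(q / 2)) := ⟨_, rfl⟩
  have he : Real.exp (-(q / 2)) = 1 - y := by linarith
  rw [he] at hl hu ⊢
  have hy0 : 0 ≤ y := by
    rw [hy]
    have := Real.exp_le_one_iff.2 (by linarith : -(q / 2) ≤ 0)
    linarith
  have hy1 : y ≤ q / 2 := by linarith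
  have hy2 : ρ * q - ρ * q ^ 2 / 4 ≤ 2 * ρ * y := by nlinarith
  have hy3 : 2 * ρ * y ≤ ρ * q := by nlinarith
  have hy4 : ρ ^ 2 * y ^ 2 ≤ ρ * q ^ 2 / 4 := by
    have h1 : y ^ 2 ≤ (q / 2) ^ 2 := pow_le_pow_left₀ hy0 hy1 2
    have h2 : ρ ^ 2 ≤ ρ := by nlinarith
    calc ρ ^ 2 * y ^ 2 ≤ ρ * (q / 2) ^ 2 := mul_le_mul h2 h1 (sq_nonneg _) hρ.le
      _ = _ := by ring
  have hy5 : 0 ≤ ρ ^ 2 * y ^ 2 := by positivity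
  have hexp : (1 - ρ + ρ * (1 - y)) ^ 2 = 1 - 2 * ρ * y + ρ ^ 2 * y ^ 2 := by ring
  rw [hexp]
  constructor <;> linarith

/-- The `cosh - 1` part of the overlap, which comes from pairs of nonzero atoms, to first order in
`t²`. -/
theorem signal_part_bounds {ρ t D q : ℝ} (hρ : 0 < ρ) (hρ1 : ρ ≤ 1)
    (ht : t ^ 2 ≤ ρ ^ 2 / 4) (hD : 1 - t ^ 2 ≤ D) (hD1 : D ≤ 1) (hq0 : 0 ≤ q)
    (hq : q ≤ 4 / 3 * (t ^ 2 / ρ)) :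
    t ^ 2 / 2 - 2 * (t ^ 4 / ρ ^ 2) ≤ ρ ^ 2 * Real.exp (-q) * (Real.cosh (t / ρ / D) - 1) ∧
      ρ ^ 2 * Real.exp (-q) * (Real.cosh (t / ρ / D) - 1) ≤ t ^ 2 / 2 + 3 * (t ^ 4 / ρ ^ 2) := by
  have hρ2 : ρ ^ 2 ≤ 1 := pow_le_one₀ hρ.le hρ1
  obtain ⟨T, hT⟩ : ∃ T, T = t ^ 2 := ⟨_, rfl⟩
  have hT4 : t ^ 4 = T ^ 2 := by rw [hT]; ring
  have hT0 : 0 ≤ T := hT ▸ sq_nonneg t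
  have hsq : (t / ρ / D) ^ 2 = T / ρ ^ 2 / D ^ 2 := by rw [div_pow, div_pow, hT]
  rw [← hT] at ht hD hq
  rw [hT4, ← hT]
  have hT14 : T ≤ 1 / 4 := by linarith
  have hD34 : 3 / 4 ≤ D := by linarith
  have hD0 : 0 < D := by linarith
  have hx : T / ρ ^ 2 ≤ 1 / 4 := by
    rw [div_le_iff₀ (by positivity)]
    linarith
  have hx0 : 0 ≤ T / ρ ^ 2 := by positivity
  obtain ⟨I, hI⟩ : ∃ I, I = (D ^ 2)⁻¹ := ⟨_, rfl⟩
  have hI1 : 1 ≤ I := by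
    rw [hI]
    exact (one_le_inv₀ (by positivity)).2 (pow_le_one₀ hD0.le hD1)
  have hI2 : I ≤ 16 / 9 := by
    rw [hI, inv_le_comm₀ (by positivity) (by norm_num)]
    nlinarith
  have hI3 : I ≤ 1 + 4 * T := by
    rw [hI, inv_le_iff_one_le_mul₀ (by positivity)]
    have h1 : (1 - T) ^ 2 ≤ D ^ 2 := pow_le_pow_left₀ (by linarith) hD 2
    have h2 : (1 + 4 * T) * (1 - T) ^ 2 ≤ (1 + 4 * T) * D ^ 2 := by gcongr
    nlinarith [pow_nonneg hT0 3, pow_nonneg hT0 2]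
  have hlow := half_sq_le_cosh_sub_one (t / ρ / D)
  have hw : (t / ρ / D) ^ 2 = T / ρ ^ 2 * I := by rw [hsq, hI, div_eq_mul_inv (T / ρ ^ 2)]
  have hwle : T / ρ ^ 2 * I ≤ 1 / 4 * (16 / 9) :=
    mul_le_mul hx hI2 (by linarith) (by norm_num)
  have hup := cosh_sub_one_le (x := t / ρ / D) (by rw [hw]; linarith)
  rw [hw] at hlow hup
  have he1 : 1 - q ≤ Real.exp (-q) := by linarith [Real.add_one_le_exp (-q)]
  have he2 : Real.exp (-q) ≤ 1 := Real.exp_le_one_iff.2 (by linarith)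
  obtain ⟨c, hc⟩ : ∃ c, c = ρ ^ 2 * (Real.cosh (t / ρ / D) - 1) := ⟨_, rfl⟩
  have hρx : ρ ^ 2 * (T / ρ ^ 2) = T := by field_simp
  have hclow : T * I / 2 ≤ c := by
    rw [hc]
    calc T * I / 2 = ρ ^ 2 * (T / ρ ^ 2 * I / 2) := by rw [← hρx]; field_simp
      _ ≤ _ := mul_le_mul_of_nonneg_left hlow (by positivity)
  have hε : T ^ 2 / ρ ^ 2 = ρ ^ 2 * (T / ρ ^ 2) ^ 2 := by field_simp
  have hT2 : T ^ 2 ≤ T ^ 2 / ρ ^ 2 := le_div_self (sq_nonneg _) (by positivity) hρ2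
  have hcup : c ≤ T * I / 2 + T ^ 2 / ρ ^ 2 := by
    have h1 : I ^ 2 ≤ 4 := by nlinarith
    calc c ≤ ρ ^ 2 * (T / ρ ^ 2 * I / 2 + (T / ρ ^ 2 * I) ^ 2 / 4) := by
          rw [hc]
          exact mul_le_mul_of_nonneg_left hup (by positivity)
      _ = T * I / 2 + T ^ 2 / ρ ^ 2 * (I ^ 2 / 4) := by
          rw [hε]
          field_simp
      _ ≤ T * I / 2 + T ^ 2 / ρ ^ 2 * 1 := by
          gcongr
          linarith
      _ = _ := by ring
  have hc0 : 0 ≤ c := le_trans (by positivity) hclow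
  have hgoal : ρ ^ 2 * Real.exp (-q) * (Real.cosh (t / ρ / D) - 1) = Real.exp (-q) * c := by
    rw [hc]
    ring
  rw [hgoal]
  have hqc : q * c ≤ 2 * (T ^ 2 / ρ ^ 2) := by
    have h1 : T / ρ * T ≤ T ^ 2 / ρ ^ 2 := by
      rw [div_mul_eq_mul_div, ← sq]
      exact div_le_div_of_nonneg_left (sq_nonneg _) (by positivity) (by nlinarith)
    have h2 : T ^ 2 / ρ ^ 2 ≤ T * (1 / 4) := by
      rw [sq T, mul_div_assoc]
      exact mul_le_mul_of_nonneg_left hx hT0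
    have h3 : c ≤ 3 / 2 * T := by
      have := mul_le_mul_of_nonneg_left hI2 hT0
      linarith
    calc q * c ≤ (4 / 3 * (T / ρ)) * (3 / 2 * T) :=
          mul_le_mul hq h3 hc0 (by positivity)
      _ = 2 * (T / ρ * T) := by ring
      _ ≤ _ := by linarith
  constructor
  · have h1 : (1 - q) * c ≤ Real.exp (-q) * c := mul_le_mul_of_nonneg_right he1 hc0
    have h2 : T * 1 ≤ T * I := mul_le_mul_of_nonneg_left hI1 hT0
    have h3 : (1 - q) * c = c - q * c := by ring
    linarith
  · have h1 : Real.exp (-q) * c ≤ 1 * c := mul_le_mul_of_nonneg_right he2 hc0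
    have h2 : T * I ≤ T * (1 + 4 * T) := mul_le_mul_of_nonneg_left hI3 hT0
    have h3 : T * (1 + 4 * T) = T + 4 * T ^ 2 := by ring
    linarith

/-- Near `t = 0` the overlap minus `1` is of order `t⁴ / ρ²`: the terms of order `t²` cancel, up to
`σ⁴ t²`, since the planted samples nearly have the second moments of the null law. -/
theorem abs_overlap_sub_one_le_of_small {ρ σ t : ℝ} (hρ : 0 < ρ) (hρ1 : ρ ≤ 1) (hσ : 0 < σ)
    (hσ1 : σ < 1) (ht : |t| ≤ ρ / 2) :
    |overlap ρ (1 - σ ^ 2) t - 1| ≤ 20 * (t ^ 4 / ρ ^ 2) + σ ^ 4 * t ^ 2 := by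
  obtain ⟨r, hr⟩ : ∃ r, r = 1 - σ ^ 2 := ⟨_, rfl⟩
  have hσ2 : σ ^ 2 < 1 := by nlinarith
  have hr0 : 0 ≤ r := by linarith
  have hr1 : r ≤ 1 := by rw [hr]; linarith [sq_nonneg σ]
  have ht2 : t ^ 2 ≤ ρ ^ 2 / 4 := by
    have := pow_le_pow_left₀ (abs_nonneg t) ht 2
    rw [sq_abs] at this
    linarith
  have hρ2 : ρ ^ 2 ≤ 1 := pow_le_one₀ hρ.le hρ1
  obtain ⟨β, hβ⟩ : ∃ β, β = r ^ 2 * t ^ 2 := ⟨_, rfl⟩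
  have hβ0 : 0 ≤ β := by rw [hβ]; positivity
  have hβt : β ≤ t ^ 2 := by
    rw [hβ]
    exact mul_le_of_le_one_left (sq_nonneg _) (pow_le_one₀ hr0 hr1)
  have hβ4 : β ≤ 1 / 4 := by linarith
  have hD : 0 < 1 - β := by linarith
  have hJ := inv_sqrt_one_sub_bounds hβ0 hβ4
  have hN := null_part_bounds hρ hρ1 hr0 hr1 (sq_nonneg t) hβ0 hβt hβ4
  have hS := signal_part_bounds (q := r * t ^ 2 / (ρ * (1 - β))) hρ hρ1 ht2
    (by linarith) (by linarith : 1 - β ≤ 1) (by positivity) (by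
      rw [mul_div_assoc', div_le_div_iff₀ (by positivity) hρ]
      have h1 : r * t ^ 2 ≤ t ^ 2 := mul_le_of_le_one_left (sq_nonneg _) hr1
      have h2 : 1 ≤ 4 / 3 * (1 - β) := by linarith
      calc r * t ^ 2 * ρ ≤ t ^ 2 * ρ := by gcongr
        _ ≤ t ^ 2 * ρ * (4 / 3 * (1 - β)) := le_mul_of_one_le_right (by positivity) h2
        _ = _ := by ring)
  rw [← hr, overlap_eq hρ, ← hβ]
  have hε : (t ^ 2) ^ 2 / ρ ^ 2 = t ^ 4 / ρ ^ 2 := by ring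
  rw [hε] at hN
  obtain ⟨N, hNe⟩ : ∃ N, N = (1 - ρ + ρ * Real.exp (-(r * t ^ 2 / (ρ * (1 - β))) / 2)) ^ 2 :=
    ⟨_, rfl⟩
  obtain ⟨S, hSe⟩ : ∃ S, S = ρ ^ 2 * Real.exp (-(r * t ^ 2 / (ρ * (1 - β)))) *
    (Real.cosh (t / ρ / (1 - β)) - 1) := ⟨_, rfl⟩
  obtain ⟨J, hJe⟩ : ∃ J, J = (√(1 - β))⁻¹ := ⟨_, rfl⟩
  obtain ⟨ε, hεe⟩ : ∃ ε, ε = t ^ 4 / ρ ^ 2 := ⟨_, rfl⟩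
  obtain ⟨T, hT⟩ : ∃ T, T = t ^ 2 := ⟨_, rfl⟩
  rw [← hNe, ← hεe, ← hT] at hN
  rw [← hSe, ← hεe, ← hT] at hS
  rw [← hJe] at hJ
  rw [← hNe, ← hSe, ← hJe, ← hεe, ← hT]
  have hT0 : 0 ≤ T := hT ▸ sq_nonneg t
  have hT1 : T ≤ 1 / 4 := by rw [hT]; linarith
  have hT2 : T ^ 2 ≤ ε := by
    rw [hεe, hT, ← hε]
    exact le_div_self (sq_nonneg _) (by positivity) hρ2
  have hε0 : 0 ≤ ε := le_trans (sq_nonneg _) hT2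
  have hβT : β ≤ T := hT ▸ hβt
  have hββ : β ^ 2 ≤ ε := (pow_le_pow_left₀ hβ0 hβT 2).trans hT2
  have hβTT : β * T ≤ ε := by
    have := mul_le_mul_of_nonneg_right hβT hT0
    linarith [sq T]
  -- The remainders `j` and `e` of the two factors are of order `ε = t⁴ / ρ²`. To first order the
  -- product is `1 + (r² / 2 + 1 / 2 - r) T = 1 + σ⁴ T / 2`.
  obtain ⟨j, hj⟩ : ∃ j, J = 1 + β / 2 + j := ⟨J - (1 + β / 2), by ring⟩
  obtain ⟨e, he⟩ : ∃ e, N + S = 1 + (1 / 2 - r) * T + e := ⟨N + S - (1 + (1 / 2 - r) * T), by ring⟩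
  have hj0 : 0 ≤ j := by linarith [hJ.1]
  have hj1 : j ≤ ε := by linarith [hJ.2]
  have he0 : -(4 * ε) ≤ e := by linarith [hN.1, hS.1]
  have he1 : e ≤ 4 * ε := by linarith [hN.2, hS.2]
  have hJ2 : J ≤ 2 := by
    have : β ^ 2 ≤ (1 / 4) ^ 2 := pow_le_pow_left₀ hβ0 hβ4 2
    linarith [hJ.2]
  have hJ0 : 0 ≤ J := by linarith
  have hmain : J * (N + S) - 1 = σ ^ 4 * T / 2 + (β * T / 2 * (1 / 2 - r)
      + j * (1 + (1 / 2 - r) * T) + J * e) := by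
    have hβT' : β = r ^ 2 * T := by rw [hβ, hT]
    rw [he, mul_add, show J * (1 + (1 / 2 - r) * T)
      = (1 + β / 2 + j) * (1 + (1 / 2 - r) * T) by rw [hj]]
    have : σ ^ 4 = (1 - r) ^ 2 := by rw [hr]; ring
    rw [this]
    linear_combination (1 / 2 : ℝ) * hβT'
  rw [hmain]
  have hσT : 0 ≤ σ ^ 4 * T := by positivity
  have hβT0 : 0 ≤ β * T := mul_nonneg hβ0 hT0
  have h1 : |β * T / 2 * (1 / 2 - r)| ≤ ε := by
    rw [abs_mul, abs_of_nonneg (by positivity)]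
    have : |1 / 2 - r| ≤ 1 := abs_le.2 ⟨by linarith, by linarith⟩
    calc β * T / 2 * |1 / 2 - r| ≤ β * T / 2 * 1 := by gcongr
      _ ≤ ε := by linarith
  have h2 : |j * (1 + (1 / 2 - r) * T)| ≤ 2 * ε := by
    rw [abs_mul, abs_of_nonneg hj0]
    have : |1 + (1 / 2 - r) * T| ≤ 2 := by
      have h5 : (1 / 2 - r) * T ≤ 1 * T := mul_le_mul_of_nonneg_right (by linarith) hT0
      have h6 : -1 * T ≤ (1 / 2 - r) * T := mul_le_mul_of_nonneg_right (by linarith) hT0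
      exact abs_le.2 ⟨by linarith, by linarith⟩
    calc j * |1 + (1 / 2 - r) * T| ≤ ε * 2 := mul_le_mul hj1 this (abs_nonneg _) hε0
      _ = _ := by ring
  have h3 : |J * e| ≤ 8 * ε := by
    rw [abs_mul, abs_of_nonneg hJ0]
    have : |e| ≤ 4 * ε := abs_le.2 ⟨he0, he1⟩
    calc J * |e| ≤ 2 * (4 * ε) := mul_le_mul hJ2 this (abs_nonneg _) (by norm_num)
      _ = _ := by ring
  have h4 : |σ ^ 4 * T / 2| ≤ σ ^ 4 * T := by
    rw [abs_of_nonneg (by positivity)]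
    linarith
  calc _ ≤ |σ ^ 4 * T / 2| + |β * T / 2 * (1 / 2 - r)
      + j * (1 + (1 / 2 - r) * T) + J * e| := abs_add_le _ _
    _ ≤ |σ ^ 4 * T / 2| + (|β * T / 2 * (1 / 2 - r)|
      + |j * (1 + (1 / 2 - r) * T)| + |J * e|) := by
        gcongr
        exact abs_add_three _ _ _
    _ ≤ _ := by linarith

/-! ### The truncated binomial expansion -/

theorem sum_Icc_pow_le (n k : ℕ) : ∑ j ∈ Finset.Icc 1 k, (n : ℝ) ^ j ≤ ((n : ℝ) + 1) ^ k := by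
  rw [add_pow]
  refine (Finset.sum_le_sum_of_subset_of_nonneg (t := Finset.range (k + 1)) (fun j hj => ?_)
    fun j _ _ => by positivity).trans (Finset.sum_le_sum fun j hj => ?_)
  · rw [Finset.mem_Icc] at hj
    exact Finset.mem_range.2 (by omega)
  · rw [one_pow, mul_one]
    have : 1 ≤ k.choose j := Nat.choose_pos (by have := Finset.mem_range.1 hj; omega)
    exact le_mul_of_one_le_right (by positivity) (by exact_mod_cast this)

theorem sum_Icc_half_pow_le (k : ℕ) {x : ℝ} (h0 : 0 ≤ x) (hx : x ≤ 1 / 2) :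
    ∑ j ∈ Finset.Icc 1 k, x ^ j ≤ 1 := by
  have h : ∑ j ∈ Finset.Icc 1 k, (1 / 2 : ℝ) ^ j = 1 - (1 / 2) ^ k := by
    induction k with
    | zero => simp
    | succ m ih => rw [Finset.sum_Icc_succ_top (by omega), ih, pow_succ]; ring
  calc ∑ j ∈ Finset.Icc 1 k, x ^ j ≤ ∑ j ∈ Finset.Icc 1 k, (1 / 2 : ℝ) ^ j :=
        Finset.sum_le_sum fun j _ => pow_le_pow_left₀ h0 hx j
    _ ≤ 1 := by
        rw [h]
        have : 0 ≤ (1 / 2 : ℝ) ^ k := by positivity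
        linarith

theorem sum_choose_mul_le_of_small {n k : ℕ} {G a b : ℝ} (ha : 0 ≤ a) (hb : 0 ≤ b)
    (hG : |G| ≤ a + b) :
    ∑ j ∈ Finset.Icc 1 k, (n.choose j : ℝ) * G ^ j
      ≤ ∑ j ∈ Finset.Icc 1 k, ((2 * n * a) ^ j + (2 * n * b) ^ j) := by
  refine Finset.sum_le_sum fun j _ => ?_
  have h1 : (n.choose j : ℝ) ≤ (n : ℝ) ^ j := by exact_mod_cast Nat.choose_le_pow n j
  have h2 : G ^ j ≤ (a + b) ^ j :=
    (le_abs_self _).trans ((abs_pow G j).le.trans (pow_le_pow_left₀ (abs_nonneg _) hG j))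
  calc (n.choose j : ℝ) * G ^ j ≤ (n.choose j : ℝ) * (a + b) ^ j := by gcongr
    _ ≤ (n : ℝ) ^ j * (2 ^ (j - 1) * (a ^ j + b ^ j)) := by
        gcongr
        exact add_pow_le ha hb j
    _ ≤ (n : ℝ) ^ j * (2 ^ j * (a ^ j + b ^ j)) := by
        gcongr
        · norm_num
        · exact Nat.sub_le j 1
    _ = _ := by
        rw [mul_pow, mul_pow, mul_pow, mul_pow]
        ring

theorem sum_choose_mul_le_of_large {n k : ℕ} {G X : ℝ} (hX : 1 ≤ X) (hG : |G| ≤ X) :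
    ∑ j ∈ Finset.Icc 1 k, (n.choose j : ℝ) * G ^ j ≤ ((n : ℝ) + 1) ^ k * X ^ k := by
  refine (Finset.sum_le_sum fun j hj => ?_).trans
    ((Finset.sum_mul _ _ (X ^ k)).symm.le.trans
      (mul_le_mul_of_nonneg_right (sum_Icc_pow_le n k) (by positivity)))
  have h1 : (n.choose j : ℝ) ≤ (n : ℝ) ^ j := by exact_mod_cast Nat.choose_le_pow n j
  have h2 : G ^ j ≤ X ^ j :=
    (le_abs_self _).trans ((abs_pow G j).le.trans (pow_le_pow_left₀ (abs_nonneg _) hG j))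
  have h3 : X ^ j ≤ X ^ k := pow_le_pow_right₀ hX (Finset.mem_Icc.1 hj).2
  calc (n.choose j : ℝ) * G ^ j ≤ (n.choose j : ℝ) * X ^ k := by gcongr; exact h2.trans h3
    _ ≤ _ := by gcongr

theorem mul_le_weighted_sq (x y : ℝ) {θ : ℝ} (hθ : 0 < θ) : x * y ≤ θ * x ^ 2 + θ⁻¹ * y ^ 2 := by
  have h : θ * x ^ 2 + θ⁻¹ * y ^ 2 - x * y = θ * (x - θ⁻¹ * y / 2) ^ 2 + 3 / 4 * (θ⁻¹ * y ^ 2) := by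
    field_simp
    ring
  have h2 : 0 ≤ θ * (x - θ⁻¹ * y / 2) ^ 2 + 3 / 4 * (θ⁻¹ * y ^ 2) := by positivity
  linarith

/-- The truncated binomial expansion at inner product `t` of the two hidden directions. For
`|t| ≤ ρ / 2` the overlap is of order `t⁴ / ρ²`; for larger `t` the bound `J * exp (|t| / ρ)` of the
overlap is split, with weight `θ`, into a singular and an exponential factor. -/
theorem sum_choose_overlap_le {d n k : ℕ} {ρ σ t θ : ℝ} (hd : 2 ≤ d) (hρ : 0 < ρ) (hρ1 : ρ ≤ 1)
    (hσ : 0 < σ) (hσ1 : σ < 1) (hk : 16 ≤ k) (hkρ : (k : ℝ) / √d ≤ ρ) (hn : (n : ℝ) ≤ (d : ℝ) ^ 2)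
    (ht : |t| ≤ 1) (hθ : 0 < θ) :
    ∑ j ∈ Finset.Icc 1 k, (n.choose j : ℝ) * (overlap ρ (1 - σ ^ 2) t - 1) ^ j
      ≤ ∑ j ∈ Finset.Icc 1 k, ((40 * n / ρ ^ 2) ^ j * |t| ^ (4 * j) + (2 * n * σ ^ 4) ^ j)
        + θ * ((1 - ((1 - σ ^ 2) * t) ^ 2)⁻¹) ^ k
        + θ⁻¹ * ((d : ℝ) ^ (6 * k) * Real.exp (k - (k : ℝ) ^ 2 / 16)) *
          Real.exp (k / 8 * (√d * |t|)) := by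
  have hσ2 : σ ^ 2 < 1 := by nlinarith
  have hσ2' : 0 < σ ^ 2 := by positivity
  have hr0 : 0 ≤ 1 - σ ^ 2 := by linarith
  have hr1 : 1 - σ ^ 2 < 1 := by linarith
  obtain ⟨r, hr⟩ : ∃ r, r = 1 - σ ^ 2 := ⟨_, rfl⟩
  have hd0 : (0 : ℝ) < d := by exact_mod_cast (by omega : 0 < d)
  have hsd : 0 < √(d : ℝ) := Real.sqrt_pos.2 hd0
  have ht2 : t ^ 2 ≤ 1 := by
    rw [← sq_abs]
    exact pow_le_one₀ (abs_nonneg _) ht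
  have hD0 : 0 < 1 - r ^ 2 * t ^ 2 := by
    have h1 : r ^ 2 < 1 := pow_lt_one₀ (hr ▸ hr0) (hr ▸ hr1) two_ne_zero
    have h2 : r ^ 2 * t ^ 2 ≤ r ^ 2 * 1 := by gcongr
    linarith
  have hDe : 1 - (r * t) ^ 2 = 1 - r ^ 2 * t ^ 2 := by rw [mul_pow]
  rw [← hr, hDe]
  by_cases hs : |t| ≤ ρ / 2
  · have hG := abs_overlap_sub_one_le_of_small hρ hρ1 hσ hσ1 hs
    rw [← hr] at hG
    have hb : σ ^ 4 * t ^ 2 ≤ σ ^ 4 := mul_le_of_le_one_right (by positivity) ht2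
    have h := sum_choose_mul_le_of_small (n := n) (k := k) (a := 20 * (t ^ 4 / ρ ^ 2))
      (b := σ ^ 4) (by positivity) (by positivity) (hG.trans (by linarith))
    have h2 : ∑ j ∈ Finset.Icc 1 k, ((2 * n * (20 * (t ^ 4 / ρ ^ 2))) ^ j + (2 * n * σ ^ 4) ^ j)
        = ∑ j ∈ Finset.Icc 1 k,
          ((40 * n / ρ ^ 2) ^ j * |t| ^ (4 * j) + (2 * n * σ ^ 4) ^ j) := by
      refine Finset.sum_congr rfl fun j _ => ?_
      rw [pow_mul, ← mul_pow, show |t| ^ 4 = t ^ 4 by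
        rw [show |t| ^ 4 = (|t| ^ 2) ^ 2 by ring, sq_abs]; ring]
      congr 2
      ring
    rw [h2] at h
    have h3 : 0 ≤ θ * ((1 - r ^ 2 * t ^ 2)⁻¹) ^ k := by positivity
    have h4 : 0 ≤ θ⁻¹ * ((d : ℝ) ^ (6 * k) * Real.exp (k - (k : ℝ) ^ 2 / 16)) *
          Real.exp (k / 8 * (√d * |t|)) := by positivity
    linarith
  · push Not at hs
    have hG := abs_overlap_sub_one_le hρ hρ1 hr0 hr1 ht
    rw [← hr] at hG
    have hJ := one_le_inv_sqrt hD0 (by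
      have : 0 ≤ r ^ 2 * t ^ 2 := by positivity
      linarith)
    obtain ⟨J, hJe⟩ : ∃ J, J = (√(1 - r ^ 2 * t ^ 2))⁻¹ := ⟨_, rfl⟩
    rw [← hJe] at hG hJ
    have hX : 1 ≤ J * Real.exp (|t| / ρ) :=
      one_le_mul_of_one_le_of_one_le hJ (Real.one_le_exp (by positivity))
    have h := sum_choose_mul_le_of_large (n := n) (k := k) hX hG
    have hJ2 : (J ^ k) ^ 2 = ((1 - r ^ 2 * t ^ 2)⁻¹) ^ k := by
      rw [← pow_mul, mul_comm, pow_mul, hJe, inv_pow, Real.sq_sqrt hD0.le]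
    have hkd : (k : ℝ) ≤ ρ * √d := by
      rwa [div_le_iff₀ hsd] at hkρ
    have ha : (k : ℝ) / 2 ≤ √d * |t| := by
      have : ρ / 2 * √d ≤ |t| * √d := by gcongr
      linarith
    -- The exponent is at most `a = √d |t|`. The surplus `(k / 16 - 1) a` on the right is at least
    -- `(k / 16 - 1) k / 2`, as `a ≥ k / 2`, which pays for the term `(k - k² / 16) / 2`.
    have hexp : Real.exp (|t| / ρ) ^ k
        ≤ Real.exp (k / 16 * (√d * |t|) + (k - (k : ℝ) ^ 2 / 16) / 2) := by
      rw [← Real.exp_nat_mul]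
      refine Real.exp_le_exp.2 ?_
      have h1 : (k : ℝ) * (|t| / ρ) ≤ √d * |t| := by
        rw [mul_div_assoc', div_le_iff₀ hρ]
        calc (k : ℝ) * |t| ≤ ρ * √d * |t| := by gcongr
          _ = _ := by ring
      have hk' : (16 : ℝ) ≤ k := by exact_mod_cast hk
      have h2 : ((k : ℝ) / 16 - 1) * (k / 2) ≤ (k / 16 - 1) * (√d * |t|) :=
        mul_le_mul_of_nonneg_left ha (by linarith)
      linarith
    have hn1 : ((n : ℝ) + 1) ^ k ≤ (d : ℝ) ^ (3 * k) := by
      rw [pow_mul]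
      have hd2 : (2 : ℝ) ≤ d := by exact_mod_cast hd
      refine pow_le_pow_left₀ (by positivity) ?_ k
      nlinarith [sq_nonneg ((d : ℝ) - 1)]
    obtain ⟨Y, hY⟩ : ∃ Y, Y = (d : ℝ) ^ (3 * k) *
      Real.exp (k / 16 * (√d * |t|) + (k - (k : ℝ) ^ 2 / 16) / 2) := ⟨_, rfl⟩
    have hY2 : Y ^ 2 = ((d : ℝ) ^ (6 * k) * Real.exp (k - (k : ℝ) ^ 2 / 16)) *
        Real.exp (k / 8 * (√d * |t|)) := by
      rw [hY, mul_pow, ← pow_mul, mul_assoc ((d : ℝ) ^ (6 * k)), ← Real.exp_add,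
        ← Real.exp_nat_mul]
      congr 2
      · ring
      · push_cast
        ring
    have hJY : ((n : ℝ) + 1) ^ k * (J * Real.exp (|t| / ρ)) ^ k ≤ J ^ k * Y := by
      rw [mul_pow, hY]
      calc _ ≤ (d : ℝ) ^ (3 * k) * (J ^ k *
            Real.exp (k / 16 * (√d * |t|) + (k - (k : ℝ) ^ 2 / 16) / 2)) := by gcongr
        _ = _ := by ring
    have hw := mul_le_weighted_sq (J ^ k) Y hθ
    rw [hJ2, hY2, ← mul_assoc θ⁻¹] at hw
    have h5 : 0 ≤ ∑ j ∈ Finset.Icc 1 k,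
        ((40 * n / ρ ^ 2) ^ j * |t| ^ (4 * j) + (2 * n * σ ^ 4) ^ j) :=
      Finset.sum_nonneg fun j _ => by positivity
    linarith

/-- Unlike in `integral_mono`, the smaller function need not be integrable, since otherwise its
integral is `0` by convention. -/
theorem integral_le_integral_of_le {α : Type*} [MeasurableSpace α] {μ : Measure α} {f g : α → ℝ}
    (hg : Integrable g μ) (hg0 : ∀ x, 0 ≤ g x) (hfg : ∀ x, f x ≤ g x) :
    ∫ x, f x ∂μ ≤ ∫ x, g x ∂μ := by
  by_cases hf : Integrable f μ
  · exact integral_mono hf hg hfg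
  · rw [integral_undef hf]
    exact integral_nonneg hg0

/-- The mean over the sphere of the truncated binomial expansion, bounded by the moments of a
coordinate; `Q` is any bound of the singular moment, and the weight in `sum_choose_overlap_le` is
`Q⁻¹`. -/
theorem integral_sum_choose_overlap_le {d n k : ℕ} [NeZero d] {ρ σ Q : ℝ} (hρ : 0 < ρ)
    (hρ1 : ρ ≤ 1) (hσ : 0 < σ) (hσ1 : σ < 1) (hk : 16 ≤ k) (hkd : 4 * k + 1 < d)
    (hkρ : (k : ℝ) / √d ≤ ρ) (hn : (n : ℝ) ≤ (d : ℝ) ^ 2) (hQ0 : 0 < Q)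
    (hQ : 2 ^ k * (1 + 4 * (2 * k).factorial * invSqrtMoment ^ (4 * k)) ≤ Q)
    (v : UnitSphere d) :
    ∫ u : UnitSphere d, ∑ j ∈ Finset.Icc 1 k, (n.choose j : ℝ) *
        (overlap ρ (1 - σ ^ 2) (inner ℝ (u : EuclideanSpace ℝ (Fin d)) v) - 1) ^ j
        ∂(uniformSphere d)
      ≤ ∑ j ∈ Finset.Icc 1 k, ((40 * n / ρ ^ 2) ^ j *
          (8 * (4 * j).factorial * (2 / √d) ^ (4 * j)) + (2 * n * σ ^ 4) ^ j)
        + 1 + Q * ((d : ℝ) ^ (6 * k) * Real.exp (k - (k : ℝ) ^ 2 / 16)) *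
          (4 * Real.exp ((k : ℝ) ^ 2 / 32)) := by
  have hv : ‖(v : EuclideanSpace ℝ (Fin d))‖ = 1 := by simp
  have hσ2 : σ ^ 2 < 1 := by nlinarith
  have hσ2' : 0 < σ ^ 2 := by positivity
  have hr0 : 0 ≤ 1 - σ ^ 2 := by linarith
  have hr1 : 1 - σ ^ 2 < 1 := by linarith
  have hc : ∀ f : UnitSphere d → ℝ, Continuous f → Integrable f (uniformSphere d) := fun f hf =>
    hf.integrable_of_hasCompactSupport (HasCompactSupport.of_compactSpace _)
  have hi1 : ∀ j, Integrable (fun u : UnitSphere d => (40 * n / ρ ^ 2) ^ j *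
      |inner ℝ (u : EuclideanSpace ℝ (Fin d)) v| ^ (4 * j)) (uniformSphere d) := fun j =>
    hc _ (by fun_prop)
  have hi1' : ∀ j, Integrable (fun u : UnitSphere d => (40 * n / ρ ^ 2) ^ j *
      |inner ℝ (u : EuclideanSpace ℝ (Fin d)) v| ^ (4 * j) + (2 * n * σ ^ 4) ^ j)
      (uniformSphere d) := fun j => (hi1 j).add (integrable_const _)
  have hi2 := (integrable_inv_pow (v : EuclideanSpace ℝ (Fin d)) hv hr0 hr1 k).const_mul Q⁻¹
  have hi3 : Integrable (fun u : UnitSphere d => (Q⁻¹)⁻¹ *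
      ((d : ℝ) ^ (6 * k) * Real.exp (k - (k : ℝ) ^ 2 / 16)) *
      Real.exp (k / 8 * (√d * |inner ℝ (u : EuclideanSpace ℝ (Fin d)) v|))) (uniformSphere d) :=
    hc _ (by fun_prop)
  have hi12 : Integrable (fun u : UnitSphere d => ∑ j ∈ Finset.Icc 1 k, ((40 * n / ρ ^ 2) ^ j *
      |inner ℝ (u : EuclideanSpace ℝ (Fin d)) v| ^ (4 * j) + (2 * n * σ ^ 4) ^ j) +
      Q⁻¹ * ((1 - ((1 - σ ^ 2) * inner ℝ (u : EuclideanSpace ℝ (Fin d)) v) ^ 2)⁻¹) ^ k)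
      (uniformSphere d) := (integrable_finsetSum _ fun j _ => hi1' j).add hi2
  have hpos := one_sub_mul_inner_sq_pos (v : EuclideanSpace ℝ (Fin d)) hv hr0 hr1
  refine (integral_le_integral_of_le (hi12.add hi3) (fun u => ?_) fun u => ?_).trans ?_
  · have := hpos u
    simp only [Pi.add_apply]
    refine add_nonneg (add_nonneg (Finset.sum_nonneg fun j _ => by positivity) (by positivity))
      (by positivity)
  · refine sum_choose_overlap_le (by omega) hρ hρ1 hσ hσ1 hk hkρ hn ?_ (by positivity)
    have := abs_real_inner_le_norm (u : EuclideanSpace ℝ (Fin d)) v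
    simpa using this
  · simp only [Pi.add_apply]
    rw [integral_add hi12 hi3, integral_add (integrable_finsetSum _ fun j _ => hi1' j) hi2,
      integral_finsetSum _ fun j _ => hi1' j, integral_const_mul, integral_const_mul, inv_inv]
    have hS := (integral_uniformSphere_inv_pow_le hkd (v : EuclideanSpace ℝ (Fin d)) hv hr0
      hr1).trans hQ
    have hE := integral_uniformSphere_exp_abs_le (by omega) (v : EuclideanSpace ℝ (Fin d)) hv
      (c := (k : ℝ) / 8) (by positivity)
    rw [show 2 * ((k : ℝ) / 8) ^ 2 = (k : ℝ) ^ 2 / 32 by ring] at hE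
    refine add_le_add (add_le_add (Finset.sum_le_sum fun j _ => ?_) ?_)
      (mul_le_mul_of_nonneg_left hE (by positivity))
    · rw [integral_add (hi1 j) (integrable_const _), integral_const_mul]
      simp only [integral_const, probReal_univ, smul_eq_mul, one_mul]
      gcongr
      exact integral_uniformSphere_abs_pow_le (by omega) _ hv (4 * j)
    · calc Q⁻¹ * _ ≤ Q⁻¹ * Q := mul_le_mul_of_nonneg_left hS (by positivity)
        _ = 1 := inv_mul_cancel₀ hQ0.ne'

/-! ### Choice of constants -/

/-- The singular moment is at most `(C d) ^ k`, since `(2 k)! ≤ (4 k²) ^ k` and `k² ≤ d`. -/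
theorem singular_moment_le {d k : ℕ} {c : ℝ} (hc : 0 ≤ c) (hk : 1 ≤ k) (hkd : (k : ℝ) ^ 2 ≤ d)
    (hd : 32 * (1 + c ^ 4) ≤ d) :
    2 ^ k * (1 + 4 * (2 * k).factorial * c ^ (4 * k)) ≤ (d : ℝ) ^ (2 * k) := by
  have hd1 : (1 : ℝ) ≤ d := by
    have : (0 : ℝ) ≤ c ^ 4 := by positivity
    linarith
  have hf : ((2 * k).factorial : ℝ) ≤ (4 * (d : ℝ)) ^ k := by
    have h1 : ((2 * k).factorial : ℝ) ≤ ((2 * k : ℕ) : ℝ) ^ (2 * k) := by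
      exact_mod_cast Nat.factorial_le_pow (2 * k)
    refine h1.trans ?_
    rw [pow_mul]
    refine pow_le_pow_left₀ (by positivity) ?_ k
    push_cast
    nlinarith
  have h4 : (4 : ℝ) ≤ 4 ^ k := le_self_pow₀ (by norm_num) (by omega)
  have h1 : 1 + 4 * (2 * k).factorial * c ^ (4 * k) ≤ (1 + 16 * d * c ^ 4) ^ k := by
    calc 1 + 4 * (2 * k).factorial * c ^ (4 * k)
        ≤ 1 + 4 ^ k * (4 * (d : ℝ)) ^ k * c ^ (4 * k) := by gcongr
      _ = 1 ^ k + (16 * d * c ^ 4) ^ k := by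
          rw [one_pow, pow_mul c, ← mul_pow, ← mul_pow]
          ring_nf
      _ ≤ (1 + 16 * d * c ^ 4) ^ k := pow_add_pow_le zero_le_one (by positivity) (by omega)
  calc _ ≤ 2 ^ k * (1 + 16 * d * c ^ 4) ^ k := by gcongr
    _ = (2 * (1 + 16 * d * c ^ 4)) ^ k := by rw [mul_pow]
    _ ≤ ((d : ℝ) ^ 2) ^ k := by
        refine pow_le_pow_left₀ (by positivity) ?_ k
        have : 32 * (1 + c ^ 4) * d ≤ d * d := by gcongr
        nlinarith [pow_nonneg hc 4]
    _ = _ := by rw [← pow_mul]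

/-- With `l = log d` the left side is at most `exp (8 k l + k - k² / 32 + 2)`, which is at most `1`
because `k ≥ l² ≥ 257 l`. -/
theorem tail_term_le {d k : ℕ} (hd : 257 ≤ Real.log d) (hk : Real.log d ^ 2 ≤ k) :
    (d : ℝ) ^ (2 * k) * ((d : ℝ) ^ (6 * k) * Real.exp (k - (k : ℝ) ^ 2 / 16)) *
      (4 * Real.exp ((k : ℝ) ^ 2 / 32)) ≤ 1 := by
  have hd0 : (0 : ℝ) < d := by
    rcases Nat.eq_zero_or_pos d with h | h
    · rw [h] at hd
      norm_num at hd
    · exact_mod_cast h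
  have hpow : ∀ m : ℕ, (d : ℝ) ^ m = Real.exp (m * Real.log d) := by
    intro m
    rw [Real.exp_nat_mul, Real.exp_log hd0]
  obtain ⟨l, hl⟩ : ∃ l, l = Real.log d := ⟨_, rfl⟩
  have h4 : (4 : ℝ) ≤ Real.exp 2 := by
    have := Real.quadratic_le_exp_of_nonneg (show (0 : ℝ) ≤ 2 by norm_num)
    linarith
  rw [hpow, hpow, ← hl]
  rw [← hl] at hd hk
  calc _ ≤ Real.exp ((2 * k : ℕ) * l) * (Real.exp ((6 * k : ℕ) * l) *
        Real.exp (k - (k : ℝ) ^ 2 / 16)) * (Real.exp 2 * Real.exp ((k : ℝ) ^ 2 / 32)) := by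
        gcongr
    _ = Real.exp (8 * k * l + k - (k : ℝ) ^ 2 / 32 + 2) := by
        rw [← Real.exp_add, ← Real.exp_add, ← Real.exp_add, ← Real.exp_add]
        push_cast
        ring_nf
    _ ≤ 1 := by
        refine Real.exp_le_one_iff.2 ?_
        have hk1 : (1 : ℝ) ≤ k := by nlinarith
        have h1 : 256 * l + 96 ≤ k := by nlinarith
        have h2 : (256 * l + 96) * k ≤ (k : ℝ) * k := by gcongr
        nlinarith

/-- The contribution of `|t| ≤ ρ / 2`: two geometric series, of ratios of order `k ^ (-4)` and
`d ^ (-2)`. -/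
theorem small_terms_le {d n k : ℕ} {ρ σ : ℝ} (hd : 2 ≤ d) (hρ : 0 < ρ) (hσ : 0 < σ)
    (hσd : σ ≤ (d : ℝ)⁻¹) (hk : 1000 ≤ k)
    (hn : (n : ℝ) ≤ ρ ^ 2 * (d : ℝ) ^ 2 / (k : ℝ) ^ 8) (hn2 : (n : ℝ) ≤ (d : ℝ) ^ 2) :
    ∑ j ∈ Finset.Icc 1 k, ((40 * n / ρ ^ 2) ^ j *
          (8 * (4 * j).factorial * (2 / √d) ^ (4 * j)) + (2 * n * σ ^ 4) ^ j) ≤ 9 := by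
  have hd2 : (2 : ℝ) ≤ d := by exact_mod_cast hd
  have hk' : (1000 : ℝ) ≤ k := by exact_mod_cast hk
  have hd0 : (0 : ℝ) < d := by linarith
  have hk0 : (0 : ℝ) < k := by linarith
  rw [Finset.sum_add_distrib]
  have h1 : ∑ j ∈ Finset.Icc 1 k, (2 * n * σ ^ 4) ^ j ≤ 1 := by
    refine sum_Icc_half_pow_le k (by positivity) ?_
    calc 2 * n * σ ^ 4 ≤ 2 * (d : ℝ) ^ 2 * ((d : ℝ)⁻¹) ^ 4 := by gcongr
      _ = 2 / (d : ℝ) ^ 2 := by field_simp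
      _ ≤ 1 / 2 := by
          rw [div_le_div_iff₀ (by positivity) (by norm_num)]
          nlinarith
  have h2 : ∀ j ∈ Finset.Icc 1 k, (40 * n / ρ ^ 2) ^ j *
      (8 * (4 * j).factorial * (2 / √d) ^ (4 * j)) ≤ 8 * (163840 / (k : ℝ) ^ 4) ^ j := by
    intro j hj
    have hf : ((4 * j).factorial : ℝ) ≤ ((4 * (k : ℝ)) ^ 4) ^ j := by
      have ha : ((4 * j).factorial : ℝ) ≤ ((4 * j : ℕ) : ℝ) ^ (4 * j) := by
        exact_mod_cast Nat.factorial_le_pow (4 * j)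
      have hjk : (j : ℝ) ≤ k := by exact_mod_cast (Finset.mem_Icc.1 hj).2
      rw [← pow_mul]
      refine ha.trans (pow_le_pow_left₀ (by positivity) ?_ _)
      push_cast
      linarith
    have hs : (2 / √(d : ℝ)) ^ (4 * j) = (16 / (d : ℝ) ^ 2) ^ j := by
      rw [pow_mul, div_pow, show √(d : ℝ) ^ 4 = (√(d : ℝ) ^ 2) ^ 2 by ring, Real.sq_sqrt hd0.le]
      norm_num
    have hnn : 40 * n / ρ ^ 2 ≤ 40 * (d : ℝ) ^ 2 / (k : ℝ) ^ 8 := by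
      rw [div_le_iff₀ (by positivity)]
      calc 40 * (n : ℝ) ≤ 40 * (ρ ^ 2 * (d : ℝ) ^ 2 / (k : ℝ) ^ 8) := by gcongr
        _ = _ := by ring
    calc _ ≤ (40 * (d : ℝ) ^ 2 / (k : ℝ) ^ 8) ^ j *
          (8 * ((4 * (k : ℝ)) ^ 4) ^ j * (16 / (d : ℝ) ^ 2) ^ j) := by
          rw [hs]
          gcongr
      _ = 8 * ((40 * (d : ℝ) ^ 2 / (k : ℝ) ^ 8) * (4 * (k : ℝ)) ^ 4 * (16 / (d : ℝ) ^ 2)) ^ j := by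
          rw [mul_pow (_ * _), mul_pow (40 * (d : ℝ) ^ 2 / (k : ℝ) ^ 8)]
          ring
      _ = _ := by
          congr 2
          field_simp
          ring
  have h3 : ∑ j ∈ Finset.Icc 1 k, (40 * n / ρ ^ 2) ^ j *
      (8 * (4 * j).factorial * (2 / √d) ^ (4 * j)) ≤ 8 * 1 := by
    refine (Finset.sum_le_sum h2).trans ?_
    rw [← Finset.mul_sum]
    gcongr
    refine sum_Icc_half_pow_le k (by positivity) ?_
    rw [div_le_div_iff₀ (by positivity) (by norm_num)]
    have : (1000 : ℝ) ^ 4 ≤ (k : ℝ) ^ 4 := by gcongr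
    linarith
  linarith

end SparsePlanted

theorem mainTheorem3 :
    ∃ (K C : ℝ) (d₀ : ℕ), 0 < K ∧
      ∀ (d n k : ℕ) (ρ σ : ℝ), d₀ ≤ d →
        0 < ρ → ρ ≤ 1 → 0 < σ → σ ≤ (d : ℝ) ^ (-K) →
        (k : ℝ) / √(d : ℝ) ≤ ρ →
        (n : ℝ) ≤ ρ ^ 2 * (d : ℝ) ^ 2 / (k : ℝ) ^ 8 →
        Real.log d ^ 2 ≤ (k : ℝ) →
        (k : ℝ) ≤ √((d : ℝ) / Real.log d) →
        ∃ h : MemLp (SparsePlanted.likelihoodRatio n d ρ σ) 2 (SparsePlanted.nullLaw n d),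
          ‖SparsePlanted.lowDegreeLR n d ⊤ k ρ σ h‖ ^ 2 ≤ C := by
  open SparsePlanted in
  -- The bound `257` of `log d` is what `tail_term_le` needs; `11 = 9 + 1 + 1` collects the part
  -- near `t = 0`, the singular moment and the Gaussian tail.
  refine ⟨1, 11, max ⌈Real.exp 257⌉₊ ⌈32 * (1 + invSqrtMoment ^ 4)⌉₊, one_pos,
    fun d n k ρ σ hd hρ hρ1 hσ hσd hkρ hn hk hkd => ?_⟩
  have hde : Real.exp 257 ≤ d := Nat.ceil_le.1 ((le_max_left _ _).trans hd)
  have hdA : 32 * (1 + invSqrtMoment ^ 4) ≤ d := Nat.ceil_le.1 ((le_max_right _ _).trans hd)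
  have hd0 : (0 : ℝ) < d := (Real.exp_pos _).trans_le hde
  have hl : 257 ≤ Real.log d := (Real.le_log_iff_exp_le hd0).2 hde
  have hk66 : (66049 : ℝ) ≤ k := by nlinarith
  have hk66' : 66049 ≤ k := by exact_mod_cast hk66
  have hkd2 : (k : ℝ) ^ 2 ≤ d / Real.log d := by
    have := pow_le_pow_left₀ (by positivity) hkd 2
    rwa [Real.sq_sqrt (by positivity)] at this
  have hkd' : (k : ℝ) ^ 2 ≤ d := hkd2.trans (div_le_self hd0.le (by linarith))
  have hkdN : k ^ 2 ≤ d := by exact_mod_cast hkd'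
  have hd4 : 4 * k + 1 < d := by nlinarith
  have : NeZero d := ⟨by omega⟩
  have hσd' : σ ≤ (d : ℝ)⁻¹ := by rwa [Real.rpow_neg_one] at hσd
  have hd2 : (2 : ℝ) ≤ d := by nlinarith
  have hσ1 : σ < 1 := hσd'.trans_lt (inv_lt_one_of_one_lt₀ (by linarith))
  have hn2 : (n : ℝ) ≤ (d : ℝ) ^ 2 := by
    refine hn.trans ((div_le_self (by positivity) (one_le_pow₀ (by linarith))).trans ?_)
    exact mul_le_of_le_one_left (by positivity) (pow_le_one₀ hρ.le hρ1)
  obtain ⟨h, hle⟩ := exists_norm_lowDegreeLR_sq_le (d := d) (n := n) hρ.le hρ1 hσ hσ1 k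
  refine ⟨h, hle.trans ?_⟩
  have hv : ∀ v : UnitSphere d, ∫ u : UnitSphere d, ∑ j ∈ Finset.Icc 1 k, (n.choose j : ℝ) *
      (overlap ρ (1 - σ ^ 2) (inner ℝ (u : EuclideanSpace ℝ (Fin d)) v) - 1) ^ j
        ∂(uniformSphere d) ≤ 11 := by
    intro v
    have h1 := integral_sum_choose_overlap_le hρ hρ1 hσ hσ1 (by omega) hd4 hkρ hn2
      (by positivity : (0 : ℝ) < (d : ℝ) ^ (2 * k))
      (singular_moment_le invSqrtMoment_nonneg (by omega) hkd' hdA) v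
    have h2 := small_terms_le (by omega) hρ hσ hσd' (by omega : 1000 ≤ k) hn hn2
    have h3 := tail_term_le hl hk
    linarith
  refine (integral_le_integral_of_le (integrable_const (11 : ℝ)) (fun _ => by norm_num) hv).trans ?_
  simp
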